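/- Let $M$ be a finite-dimensional Hausdorff smooth manifold without boundary. Write $\Omega(M)=\bigoplus_p\Omega^p(M)$ for the differential forms on $M$ and $\Omega^p(M;TM)$ for the $TM$-valued $p$-forms. For $K\in\Omega^m(M;TM)$ let $i_K:\Omega(M)\to\Omega(M)$ be the insertion operator, of degree $m-1$: it vanishes on $\Omega^0(M)$, and for $\omega\in\Omega^{q+1}(M)$ $$(i_K\omega)(X_1,\dots,X_{m+q})=\frac1{m!\,q!}\sum_{\sigma\in S_{m+q}}\operatorname{sgn}(\sigma)\,\omega\bigl(K(X_{\sigma(1)},\dots,X_{\sigma(m)}),X_{\sigma(m+1)},\dots,X_{\sigma(m+q)}\bigr).$$ For operators $D_1,D_2$ on $\Omega(M)$ of degrees $k,l$ put $[D_1,D_2]=D_1D_2-(-1)^{kl}D_2D_1$, and put $\mathcal L_K=[i_K,d]$, of degree $m$. The Richardson–Nijenhuis bracket of $K\in\Omega^{k+1}(M;TM)$ and $L\in\Omega^{l+1}(M;TM)$ is the unique $[K,L]_{RN}\in\Omega^{k+l+1}(M;TM)$ with $[i_K,i_L]=i_{[K,L]_{RN}}$; the Frölicher–Nijenhuis bracket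 of $K\in\Omega^{k}(M;TM)$ and $L\in\Omega^{l}(M;TM)$ is the unique $[K,L]_{FN}\in\Omega^{k+l}(M;TM)$ with $[\mathcal L_K,\mathcal L_L]=\mathcal L_{[K,L]_{FN}}$. The Nijenhuis torsion of an endomorphism $N$ of $TM$ is $T_N=\tfrac12[N,N]_{FN}\in\Omega^2(M;TM)$, that is, $$T_N(X,Y)=[NX,NY]-N[NX,Y]-N[X,NY]+N^2[X,Y].$$ **Proposition.** Let $N:TM\to TM$ be an endomorphism with $N^2=N$ whose image is involutive (the vector fields with values in $\operatorname{Im}N$ are closed under the Lie bracket), and let $L=-T_N$. Then $NL=-T_N$, $[N,L]_{FN}=0$, $[L,L]_{RN}=0$, and $T_N(T_N(X,Y),Z)=0$ for all vector fields $X,Y,Z$. The same holds in the complex case: for complex-valued forms, complex vector fields $X+iY$, and a complex-linear endomorphism $N$ of the complexified tangent bundle $TM\otimes\mathbb C$, with the Lie bracket, $d$ and all the operations above extended complex-linearly. -/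

import Mathlib

namespace FrolicherNijenhuis

noncomputable section

open scoped Nat

/- Forms, insertion, exterior derivative and the two brackets, for a commutative ring `A` of
functions and an `A`-module `L` of vector fields. -/

section Forms
variable (A L : Type*) [CommRing A] [AddCommGroup L] [Module A L]

/-- The `p`-forms: alternating `A`-multilinear maps of `p` elements of `L` with values in `A`.
For `A` the smooth functions and `L` the vector fields on a manifold `M`, this is `Ω^p(M)`. -/
abbrev Form (p : ℕ) := L [⋀^Fin p]→ₗ[A] A

/-- The vector-valued `p`-forms: alternating `A`-multilinear maps of `p` elements of `L` with
values in `L`.  For `A` the smooth functions and `L` the vector fields on a manifold `M`, this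
is `Ω^p(M; TM)`. -/
abbrev VectorForm (p : ℕ) := L [⋀^Fin p]→ₗ[A] L

/-- All forms, `Ω = ⨁ p, Ω^p`. -/
abbrev Forms := DirectSum ℕ (fun p => Form A L p)
end Forms

section Insertion
variable {A L : Type*} [CommRing A] [AddCommGroup L] [Module A L] {m q : ℕ}

/-- The multilinear map `(Z₀, …) ↦ ω(K(Z₀, …, Z_{m-1}), Z_m, …, Z_{m+q-1})`. -/
def insertionAux (K : VectorForm A L m) (ω : Form A L (q + 1)) :
    MultilinearMap A (fun _ : Fin (m + q) => L) A :=
  MultilinearMap.mk' (fun Z =>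
      ω (Fin.cons (K fun i => Z (Fin.castAdd q i)) fun j => Z (Fin.natAdd m j)))
    (fun Z i x y => by
      have hl (i : Fin m) (z : L) : (fun k => Function.update Z (Fin.castAdd q i) z
          (Fin.castAdd q k)) = Function.update (fun k => Z (Fin.castAdd q k)) i z := by
        ext k; simp [Function.update_apply]
      have hl' (i : Fin m) (z : L) : (fun k => Function.update Z (Fin.castAdd q i) z
          (Fin.natAdd m k)) = fun k => Z (Fin.natAdd m k) := by
        ext k; simp [Function.update_apply, Fin.ext_iff]; grind
      have hr (j : Fin q) (z : L) : (fun k => Function.update Z (Fin.natAdd m j) z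
          (Fin.castAdd q k)) = fun k => Z (Fin.castAdd q k) := by
        ext k; simp [Function.update_apply, Fin.ext_iff]; grind
      have hr' (j : Fin q) (z : L) : (fun k => Function.update Z (Fin.natAdd m j) z
          (Fin.natAdd m k)) = Function.update (fun k => Z (Fin.natAdd m k)) j z := by
        ext k; simp [Function.update_apply]
      refine Fin.addCases (fun i => ?_) (fun i => ?_) i
      · simp only [hl, hl', AlternatingMap.map_update_add]
        exact ω.toMultilinearMap.cons_add _ _ _
      · simp only [hr, hr', Fin.cons_update, AlternatingMap.map_update_add])
    (fun Z i c x => by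
      have hl (i : Fin m) (z : L) : (fun k => Function.update Z (Fin.castAdd q i) z
          (Fin.castAdd q k)) = Function.update (fun k => Z (Fin.castAdd q k)) i z := by
        ext k; simp [Function.update_apply]
      have hl' (i : Fin m) (z : L) : (fun k => Function.update Z (Fin.castAdd q i) z
          (Fin.natAdd m k)) = fun k => Z (Fin.natAdd m k) := by
        ext k; simp [Function.update_apply, Fin.ext_iff]; grind
      have hr (j : Fin q) (z : L) : (fun k => Function.update Z (Fin.natAdd m j) z
          (Fin.castAdd q k)) = fun k => Z (Fin.castAdd q k) := by
        ext k; simp [Function.update_apply, Fin.ext_iff]; grind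
      have hr' (j : Fin q) (z : L) : (fun k => Function.update Z (Fin.natAdd m j) z
          (Fin.natAdd m k)) = Function.update (fun k => Z (Fin.natAdd m k)) j z := by
        ext k; simp [Function.update_apply]
      refine Fin.addCases (fun i => ?_) (fun i => ?_) i
      · simp only [hl, hl', AlternatingMap.map_update_smul]
        exact ω.toMultilinearMap.cons_smul _ _ _
      · simp only [hr, hr', Fin.cons_update, AlternatingMap.map_update_smul])

variable [Algebra ℝ A]

/-- Insertion of a vector-valued `m`-form in a `(q + 1)`-form: the sum over all permutations `σ` of
`sgn σ • ω(K(Z_{σ 0}, …, Z_{σ (m-1)}), Z_{σ m}, …, Z_{σ (m+q-1)})`, divided by `m! q!`; this is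
the sum over the `(m, q)`-shuffles, because each shuffle accounts for `m! q!` equal terms. -/
def insertionSucc (K : VectorForm A L m) (ω : Form A L (q + 1)) : Form A L (m + q) :=
  ((m ! * q ! : ℝ)⁻¹) • MultilinearMap.alternatization (insertionAux K ω)

/-- The insertion operator `i_K` on `Ω`; it vanishes on functions. -/
def insertion (K : VectorForm A L m) : Forms A L →+ Forms A L :=
  DirectSum.toAddMonoid fun p =>
    match p with
    | 0 => 0
    | q + 1 => (DirectSum.of (fun p => Form A L p) (m + q)).comp
        (AddMonoidHom.mk' (insertionSucc K) fun ω η => by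
          have h : insertionAux K (ω + η) = insertionAux K ω + insertionAux K η := by
            ext Z; rfl
          simp only [insertionSucc, h, map_add, smul_add])

end Insertion

section Ext
variable {A L : Type*} [CommRing A] [LieRing L] [Module A L] [LieRingModule L A] {n : ℕ}

/-- The Koszul formula for the exterior derivative of an `(n + 1)`-form,
`∑ i, (-1)^i X_i(ω(… omit X_i …)) + ∑ i < j, (-1)^(i+j) ω([X_i, X_j], … omit X_i, X_j …)`.
In the second sum `(i, j)` stands for the pair of positions `i < j + 1`, hence the minus sign. -/
def koszul (ω : Form A L (n + 1)) (X : Fin (n + 2) → L) : A :=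
  (∑ i : Fin (n + 2), (-1 : ℤ) ^ (i : ℕ) • ⁅X i, ω (i.removeNth X)⁆) -
    ∑ i : Fin (n + 1), ∑ j ≥ i, (-1 : ℤ) ^ (i + j : ℕ) •
      ω (Matrix.vecCons ⁅X i.castSucc, X j.succ⁆ (j.removeNth (i.castSucc.removeNth X)))

/-- A form, regarded as an additive alternating map. -/
def intForm (ω : Form A L n) : L [⋀^Fin n]→ₗ[ℤ] A :=
  { ω.toMultilinearMap.restrictScalars ℤ with map_eq_zero_of_eq' := ω.map_eq_zero_of_eq' }

@[simp] theorem intForm_apply (ω : Form A L n) (X : Fin n → L) : intForm ω X = ω X := rfl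

/-- The map `X ↦ (Z ↦ X(ω(Z)))`. -/
def actForm (ω : Form A L n) : L →ₗ[ℤ] L [⋀^Fin n]→ₗ[ℤ] A :=
  AddMonoidHom.toIntLinearMap <| AddMonoidHom.mk'
    (fun X => (AddMonoidHom.toIntLinearMap
      (AddMonoidHom.mk' (fun a : A => ⁅X, a⁆) (lie_add X))).compAlternatingMap (intForm ω))
    (fun X Y => by ext Z; exact add_lie X Y (ω Z))

@[simp] theorem actForm_apply (ω : Form A L n) (X : L) (Z : Fin n → L) :
    actForm ω X Z = ⁅X, ω Z⁆ := rfl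

/-- The map `(X, Y) ↦ ω([X, Y], …)`. -/
def bracketForm (ω : Form A L (n + 1)) : L →ₗ[ℤ] L →ₗ[ℤ] L [⋀^Fin n]→ₗ[ℤ] A :=
  LinearMap.mk₂ ℤ (fun X Y => (intForm ω).curryLeft ⁅X, Y⁆)
    (fun X Y Z => by rw [add_lie, map_add]) (fun c X Y => by rw [zsmul_lie, map_smul])
    (fun X Y Z => by rw [lie_add, map_add]) (fun c X Y => by rw [lie_zsmul, map_smul])

@[simp] theorem bracketForm_apply (ω : Form A L (n + 1)) (X Y : L) (Z : Fin n → L) :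
    bracketForm ω X Y Z = ω (Matrix.vecCons ⁅X, Y⁆ Z) := rfl

variable [Algebra ℝ A]

/-- The Koszul formula as an additive alternating map (see `intKoszul_apply`). -/
def intKoszul (ω : Form A L (n + 1)) : L [⋀^Fin (n + 2)]→ₗ[ℤ] A :=
  AlternatingMap.alternatizeUncurryFin (actForm ω) - (2⁻¹ : ℝ) •
    AlternatingMap.alternatizeUncurryFin (AlternatingMap.alternatizeUncurryFinLM ∘ₗ bracketForm ω)

theorem intKoszul_apply (ω : Form A L (n + 1)) (X : Fin (n + 2) → L) :
    intKoszul ω X = koszul ω X := by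
  rw [intKoszul, AlternatingMap.sub_apply, AlternatingMap.smul_apply,
    AlternatingMap.alternatizeUncurryFin_alternatizeUncurryFinLM_comp_apply,
    AlternatingMap.alternatizeUncurryFin_apply, koszul]
  congr 1
  simp only [Finset.smul_sum, bracketForm_apply]
  refine Finset.sum_congr rfl fun i _ => Finset.sum_congr rfl fun j _ => ?_
  have h : ω (Matrix.vecCons ⁅X j.succ, X i.castSucc⁆ (j.removeNth (i.castSucc.removeNth X))) =
      - ω (Matrix.vecCons ⁅X i.castSucc, X j.succ⁆ (j.removeNth (i.castSucc.removeNth X))) := by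
    rw [← lie_skew]
    have := ω.toMultilinearMap.cons_smul (j.removeNth (i.castSucc.removeNth X)) (-1)
      ⁅X i.castSucc, X j.succ⁆
    simpa using! this
  rw [h, sub_neg_eq_add, ← two_smul ℝ, smul_comm (2⁻¹ : ℝ), smul_smul]
  norm_num

variable [LieRinehartRing A L]

theorem map_cons_smul (ω : Form A L (n + 1)) (c : A) (x : L) (X : Fin n → L) :
    ω (Matrix.vecCons (c • x) X) = c • ω (Matrix.vecCons x X) :=
  ω.toMultilinearMap.cons_smul X c x

theorem map_cons_cons_smul (ω : Form A L (n + 2)) (c : A) (b x : L) (X : Fin n → L) :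
    ω (Matrix.vecCons b (Matrix.vecCons (c • x) X)) =
      c • ω (Matrix.vecCons b (Matrix.vecCons x X)) :=
  map_cons_smul (ω.curryLeft b) c x X

theorem removeNth_succ_vecCons (k : Fin (n + 1)) (x : L) (X : Fin (n + 1) → L) :
    k.succ.removeNth (Matrix.vecCons x X) = Matrix.vecCons x (k.removeNth X) := by
  ext i
  refine Fin.cases ?_ (fun i => ?_) i <;> simp [Fin.removeNth_apply]

theorem koszul_vecCons (ω : Form A L (n + 1)) (x : L) (X : Fin (n + 1) → L) :
    koszul ω (Matrix.vecCons x X) = (⁅x, ω X⁆ +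
      ∑ k : Fin (n + 1), (-1 : ℤ) ^ ((k : ℕ) + 1) •
        ⁅X k, ω (Matrix.vecCons x (k.removeNth X))⁆) -
      ((∑ j : Fin (n + 1), (-1 : ℤ) ^ (j : ℕ) • ω (Matrix.vecCons ⁅x, X j⁆ (j.removeNth X))) +
        ∑ i : Fin n, ∑ j ≥ i.succ, (-1 : ℤ) ^ (i + 1 + j : ℕ) •
          ω (Matrix.vecCons ⁅X i.castSucc, X j⁆
            (j.removeNth (Matrix.vecCons x (i.castSucc.removeNth X))))) := by
  rw [koszul]
  congr 1
  · rw [Fin.sum_univ_succ]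
    simp [removeNth_succ_vecCons]
  · rw [Fin.sum_univ_succ (n := n)]
    congr 1
    · have h0 : Finset.Ici (0 : Fin (n + 1)) = Finset.univ := by ext j; simp
      simp [h0]
    · refine Finset.sum_congr rfl fun i _ => Finset.sum_congr rfl fun j _ => ?_
      rw [← Fin.succ_castSucc, removeNth_succ_vecCons]
      simp

theorem koszul_cons_smul (ω : Form A L (n + 1)) (c : A) (x : L) (X : Fin (n + 1) → L) :
    koszul ω (Matrix.vecCons (c • x) X) = c • koszul ω (Matrix.vecCons x X) := by
  have h1 : ∀ k : Fin (n + 1), (-1 : ℤ) ^ ((k : ℕ) + 1) •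
        ⁅X k, ω (Matrix.vecCons (c • x) (k.removeNth X))⁆ =
      c • ((-1 : ℤ) ^ ((k : ℕ) + 1) • ⁅X k, ω (Matrix.vecCons x (k.removeNth X))⁆) -
        (-1 : ℤ) ^ (k : ℕ) • (⁅X k, c⁆ * ω (Matrix.vecCons x (k.removeNth X))) := by
    intro k
    rw [map_cons_smul, smul_eq_mul, LieRinehartRing.leibniz_mul_right, smul_add, pow_succ,
      smul_comm c]
    simp [sub_eq_add_neg]
  have h2 : ∀ j : Fin (n + 1), (-1 : ℤ) ^ (j : ℕ) •
        ω (Matrix.vecCons ⁅c • x, X j⁆ (j.removeNth X)) =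
      c • ((-1 : ℤ) ^ (j : ℕ) • ω (Matrix.vecCons ⁅x, X j⁆ (j.removeNth X))) -
        (-1 : ℤ) ^ (j : ℕ) • (⁅X j, c⁆ * ω (Matrix.vecCons x (j.removeNth X))) := by
    intro j
    have hb : ⁅c • x, X j⁆ = c • ⁅x, X j⁆ + (-⁅X j, c⁆) • x := by
      rw [← lie_skew, LieRinehartRing.leibniz_smul_right, ← lie_skew x (X j)]
      module
    have ha : ω (Matrix.vecCons (c • ⁅x, X j⁆ + (-⁅X j, c⁆) • x) (j.removeNth X)) =
        ω (Matrix.vecCons (c • ⁅x, X j⁆) (j.removeNth X)) +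
          ω (Matrix.vecCons ((-⁅X j, c⁆) • x) (j.removeNth X)) :=
      ω.toMultilinearMap.cons_add _ _ _
    rw [hb, ha, map_cons_smul, map_cons_smul, smul_add, smul_comm c]
    simp [sub_eq_add_neg]
  have h3 : ∀ (i : Fin n), ∀ j ≥ i.succ, (-1 : ℤ) ^ (i + 1 + j : ℕ) •
          ω (Matrix.vecCons ⁅X i.castSucc, X j⁆
            (j.removeNth (Matrix.vecCons (c • x) (i.castSucc.removeNth X)))) =
      c • ((-1 : ℤ) ^ (i + 1 + j : ℕ) • ω (Matrix.vecCons ⁅X i.castSucc, X j⁆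
            (j.removeNth (Matrix.vecCons x (i.castSucc.removeNth X))))) := by
    intro i j hj
    cases n with
    | zero => exact i.elim0
    | succ n =>
      obtain ⟨k, rfl⟩ : ∃ k, j = Fin.succ k :=
        (Fin.exists_succ_eq.2 (fun h => by simp [h] at hj)).imp fun _ h => h.symm
      rw [removeNth_succ_vecCons, removeNth_succ_vecCons, map_cons_cons_smul, smul_comm c]
  rw [koszul_vecCons, koszul_vecCons, Finset.sum_congr rfl fun k _ => h1 k,
    Finset.sum_congr rfl fun k _ => h2 k,
    Finset.sum_congr rfl fun i _ => Finset.sum_congr rfl fun j hj => h3 i j (by simpa using hj)]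
  simp only [Finset.sum_sub_distrib, LieRinehartRing.lie_smul_eq_mul, smul_eq_mul, mul_sub,
    mul_add, Finset.mul_sum]
  ring

/-- The exterior derivative of an `(n + 1)`-form. -/
def extDerivSucc (ω : Form A L (n + 1)) : Form A L (n + 2) where
  toFun := koszul ω
  map_update_add' X i x y := by
    simp only [← intKoszul_apply]
    exact (intKoszul ω).map_update_add' X i x y
  map_update_smul' X i c x := by
    have key : ∀ z : L, koszul ω (Function.update X i z) =
        (-1 : ℤ) ^ (i : ℕ) • koszul ω (Matrix.vecCons z (i.removeNth X)) := by
      intro z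
      rw [← intKoszul_apply, ← intKoszul_apply, ← AlternatingMap.map_insertNth]
      congr 1
      rw [Fin.insertNth_removeNth]
      convert! rfl
    rw [key, key, koszul_cons_smul, smul_comm]
  map_eq_zero_of_eq' X i j h hij := by
    rw [← intKoszul_apply]
    exact (intKoszul ω).map_eq_zero_of_eq' X i j h hij

/-- The exterior derivative of a function: `df(X) = X(f)`. -/
def extDerivZero (f : Form A L 0) : Form A L 1 :=
  AlternatingMap.ofSubsingleton A L A (0 : Fin 1)
    { toFun := fun X => ⁅X, f ![]⁆
      map_add' := fun X Y => add_lie X Y _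
      map_smul' := fun c X => LieRinehartRing.lie_smul_eq_mul c _ X }

/-- The exterior derivative `d` on `Ω`. -/
def extDeriv : Forms A L →+ Forms A L :=
  DirectSum.toAddMonoid fun p =>
    match p with
    | 0 => (DirectSum.of (fun p => Form A L p) 1).comp
        (AddMonoidHom.mk' extDerivZero fun f g => by ext X; exact lie_add _ _ _)
    | n + 1 => (DirectSum.of (fun p => Form A L p) (n + 2)).comp
        (AddMonoidHom.mk' extDerivSucc fun ω η => by
          ext X
          change koszul (ω + η) X = koszul ω X + koszul η X
          simp only [koszul, AlternatingMap.add_apply, lie_add, smul_add, Finset.sum_add_distrib]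
          abel)

/-- The graded commutator `D₁ D₂ - (-1)^(k l) D₂ D₁` of operators of degrees `k` and `l`. -/
def gradedCommutator (k l : ℤ) (D₁ D₂ : AddMonoid.End (Forms A L)) : AddMonoid.End (Forms A L) :=
  D₁ * D₂ - (Int.negOnePow (k * l) : ℤ) • (D₂ * D₁)

/-- The Lie derivative along a vector-valued `k`-form `K`: the graded commutator of `i_K`, which
has degree `k - 1`, and `d`, which has degree `1`. -/
def lieDerivative {k : ℕ} (K : VectorForm A L k) : AddMonoid.End (Forms A L) :=
  gradedCommutator ((k : ℤ) - 1) 1 (insertion K) extDeriv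

/-- `R` is the Richardson-Nijenhuis bracket of `K ∈ Ω^(k+1)` and `K' ∈ Ω^(l+1)`: the unique
vector-valued form with `[i_K, i_K'] = i_R`. -/
structure IsRNBracket {k l : ℕ} (K : VectorForm A L (k + 1)) (K' : VectorForm A L (l + 1))
    (R : VectorForm A L (k + l + 1)) : Prop where
  comm : gradedCommutator (k : ℤ) (l : ℤ) (insertion K) (insertion K') = insertion R
  unique : ∀ S : VectorForm A L (k + l + 1),
    gradedCommutator (k : ℤ) (l : ℤ) (insertion K) (insertion K') = insertion S → S = R

/-- `R` is the Frölicher-Nijenhuis bracket of `K ∈ Ω^k` and `K' ∈ Ω^l`: the unique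
vector-valued form whose Lie derivative is the graded commutator of those along `K` and `K'`. -/
structure IsFNBracket {k l : ℕ} (K : VectorForm A L k) (K' : VectorForm A L l)
    (R : VectorForm A L (k + l)) : Prop where
  comm : gradedCommutator (k : ℤ) (l : ℤ) (lieDerivative K) (lieDerivative K') = lieDerivative R
  unique : ∀ S : VectorForm A L (k + l),
    gradedCommutator (k : ℤ) (l : ℤ) (lieDerivative K) (lieDerivative K') = lieDerivative S → S = R

/-- An endomorphism as a vector-valued `1`-form. -/
def endForm (N : L →ₗ[A] L) : VectorForm A L 1 := AlternatingMap.ofSubsingleton A L L (0 : Fin 1) N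

/-- The Nijenhuis torsion `T_N(X, Y) = [NX, NY] - N[NX, Y] - N[X, NY] + N²[X, Y]`. -/
def torsion (N : L →ₗ[A] L) : VectorForm A L 2 :=
  { MultilinearMap.mk' (fun X : Fin 2 → L =>
      ⁅N (X 0), N (X 1)⁆ - N ⁅N (X 0), X 1⁆ - N ⁅X 0, N (X 1)⁆ + N (N ⁅X 0, X 1⁆))
      (fun X i x y => by
        fin_cases i <;> simp [add_lie, lie_add] <;> abel)
      (fun X i c x => by
        have hs : ∀ (a : A) (u v : L), ⁅a • u, v⁆ = a • ⁅u, v⁆ - ⁅v, a⁆ • u := by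
          intro a u v
          rw [← lie_skew, LieRinehartRing.leibniz_smul_right, ← lie_skew u v]
          module
        fin_cases i
        · simp [hs]
          module
        · simp
          module) with
    map_eq_zero_of_eq' := fun X i j h hij => by
      have h01 : X 0 = X 1 := by
        fin_cases i <;> fin_cases j <;> simp_all
      change ⁅N (X 0), N (X 1)⁆ - N ⁅N (X 0), X 1⁆ - N ⁅X 0, N (X 1)⁆ + N (N ⁅X 0, X 1⁆) = 0
      rw [h01, ← lie_skew (N (X 1)) (X 1), lie_self, lie_self, map_neg, map_zero, map_zero]
      abel }

/-- The image of `N` is closed under the Lie bracket. -/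
def HasInvolutiveImage (N : L →ₗ[A] L) : Prop :=
  ∀ X ∈ LinearMap.range N, ∀ Y ∈ LinearMap.range N, ⁅X, Y⁆ ∈ LinearMap.range N

end Ext

/- Real and complex vector fields on a manifold. -/

open scoped Manifold ContDiff Bundle
open VectorField

section Real
variable {E : Type*} [NormedAddCommGroup E] [NormedSpace ℝ E] [FiniteDimensional ℝ E]
  {H : Type*} [TopologicalSpace H] (I : ModelWithCorners ℝ E H)
  (M : Type*) [TopologicalSpace M] [ChartedSpace H M] [IsManifold I ∞ M]

/-- Smooth real functions on `M`. -/
abbrev SmoothFunction := C^∞⟮I, M; 𝓘(ℝ, ℝ), ℝ⟯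
/-- Smooth vector fields: smooth sections of the tangent bundle.  They carry the Lie bracket
`mlieBracket`, and act on functions by differentiation; `C^∞(M)`-linear endomorphisms of this
module are the endomorphisms of the bundle `TM`. -/
abbrev SmoothVectorField := Cₛ^∞⟮I; E, (TangentSpace I : M → Type _)⟯

variable {I M}
namespace SmoothVectorField

instance : SMul (SmoothFunction I M) (SmoothVectorField I M) :=
  ⟨fun f X => ⟨fun x => f x • X x, f.contMDiff.smul_section X.contMDiff⟩⟩

@[simp] theorem fun_smul_apply (f : SmoothFunction I M) (X : SmoothVectorField I M) (x : M) :
    (f • X) x = f x • X x := rfl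

instance : Module (SmoothFunction I M) (SmoothVectorField I M) where
  one_smul X := by ext x; exact one_smul ℝ (X x)
  mul_smul f g X := by ext x; exact mul_smul (f x) (g x) (X x)
  smul_zero f := by ext x; exact smul_zero (f x)
  smul_add f X Y := by ext x; exact smul_add (f x) (X x) (Y x)
  add_smul f g X := by ext x; exact add_smul (f x) (g x) (X x)
  zero_smul X := by ext x; exact zero_smul ℝ (X x)

theorem mdiffAt (X : SmoothVectorField I M) (x : M) :
    MDifferentiableAt I I.tangent (fun y => (⟨y, X y⟩ : TangentBundle I M)) x := 
  X.mdifferentiableAt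

instance : Bracket (SmoothVectorField I M) (SmoothVectorField I M) :=
  ⟨fun X Y => ⟨mlieBracket I X Y, fun x => by
    have : CompleteSpace E := FiniteDimensional.complete ℝ E
    have : IsManifold I ((⊤ : ℕ∞) + 1) M := by simpa using (inferInstance : IsManifold I ∞ M)
    have : IsManifold I (minSmoothness ℝ 2) M := by
      simpa using (inferInstance : IsManifold I 2 M)
    exact ContMDiffAt.mlieBracket_vectorField (m := ⊤) (n := ⊤) (X.contMDiff x) (Y.contMDiff x)
      (by simp)⟩⟩

@[simp] theorem lie_apply (X Y : SmoothVectorField I M) (x : M) :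
    (⁅X, Y⁆ : SmoothVectorField I M) x = mlieBracket I X Y x := rfl

theorem two_le_smooth : minSmoothness ℝ 2 ≤ ∞ := by
  simpa using (WithTop.coe_le_coe.2 (le_top : (2 : ℕ∞) ≤ ⊤))

instance : LieRing (SmoothVectorField I M) where
  add_lie X Y Z := by ext x; exact mlieBracket_add_left (X.mdiffAt x) (Y.mdiffAt x)
  lie_add X Y Z := by ext x; exact mlieBracket_add_right (Y.mdiffAt x) (Z.mdiffAt x)
  lie_self X := by ext x; simp
  leibniz_lie X Y Z := by
    have : CompleteSpace E := FiniteDimensional.complete ℝ E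
    have : IsManifold I (minSmoothness ℝ 3) M := by simpa using (inferInstance : IsManifold I 3 M)
    ext x
    exact leibniz_identity_mlieBracket_apply ((X.contMDiff x).of_le two_le_smooth)
      ((Y.contMDiff x).of_le two_le_smooth) ((Z.contMDiff x).of_le two_le_smooth)

instance : Bracket (SmoothVectorField I M) (SmoothFunction I M) :=
  ⟨fun X f => ⟨fun x => mvfderiv I f x (X x), by
    have h1 := (f.contMDiff.contMDiff_tangentMap (m := ∞) (by simp)).comp X.contMDiff
    exact (contMDiff_snd_tangentBundle_modelSpace ℝ 𝓘(ℝ, ℝ)).comp h1⟩⟩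

@[simp] theorem lie_fun_apply (X : SmoothVectorField I M) (f : SmoothFunction I M) (x : M) :
    (⁅X, f⁆ : SmoothFunction I M) x = mvfderiv I f x (X x) := rfl


theorem lie_lie_fun_aux (X Y : SmoothVectorField I M) (f : SmoothFunction I M) (x : M)
    (v : TangentSpace I x) :
    (⁅⁅X, Y⁆, f⁆ : SmoothFunction I M) x • v =
      ((⁅X, ⁅Y, f⁆⁆ : SmoothFunction I M) x - (⁅Y, ⁅X, f⁆⁆ : SmoothFunction I M) x) • v := by
  have : CompleteSpace E := FiniteDimensional.complete ℝ E
  have i3 : IsManifold I (minSmoothness ℝ 3) M := by simpa using (inferInstance : IsManifold I 3 M)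
  have i2 : IsManifold I (minSmoothness ℝ 2) M := by simpa using (inferInstance : IsManifold I 2 M)
  have i21 : IsManifold I ((2 : ℕ∞) + 1) M := by
    have h : ((2 : ℕ∞) : WithTop ℕ∞) + 1 = 3 := by norm_num
    rw [h]; infer_instance
  let Z : ∀ y : M, TangentSpace I y := FiberBundle.extend E v
  have hZx : Z x = v := by simp [Z]
  have hZ : ContMDiffAt I I.tangent ∞ (fun y => (⟨y, Z y⟩ : TangentBundle I M)) x :=
    FiberBundle.contMDiffAt_extend I E v
  have hZd : ∀ᶠ y in nhds x, MDifferentiableAt I I.tangent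
      (fun y => (⟨y, Z y⟩ : TangentBundle I M)) y := by
    have h1 := (contMDiffAt_iff_contMDiffAt_nhds (n := 1) (by simp)).1 (hZ.of_le (by simp))
    exact h1.mono fun y hy => hy.mdifferentiableAt one_ne_zero
  have key : ∀ (W : SmoothVectorField I M),
      mlieBracket I W ((f : M → ℝ) • Z) =ᶠ[nhds x]
        ((⁅W, f⁆ : SmoothFunction I M) : M → ℝ) • Z + (f : M → ℝ) • mlieBracket I W Z := by
    intro W
    filter_upwards [hZd] with y hy
    exact mlieBracket_smul_right f.mdifferentiableAt hy
  have hb : ∀ (W : SmoothVectorField I M), MDifferentiableAt I I.tangent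
      (fun y => (⟨y, mlieBracket I W Z y⟩ : TangentBundle I M)) x := by
    intro W
    have := ContMDiffAt.mlieBracket_vectorField (m := 1) (n := 2)
      ((W.contMDiff x).of_le (by simpa using two_le_smooth))
      (hZ.of_le (by simpa using two_le_smooth)) (by simp; norm_num)
    exact this.mdifferentiableAt one_ne_zero
  have key2 : ∀ U W : SmoothVectorField I M,
      mlieBracket I U (mlieBracket I W ((f : M → ℝ) • Z)) x =
        (⁅U, ⁅W, f⁆⁆ : SmoothFunction I M) x • v + ⁅W, f⁆ x • mlieBracket I U Z x +
          (⁅U, f⁆ x • mlieBracket I W Z x + f x • mlieBracket I U (mlieBracket I W Z) x) := by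
    intro U W
    refine (Filter.EventuallyEq.mlieBracket_vectorField_eq
      (Filter.EventuallyEq.refl _ _) (key W)).trans ?_
    rw [mlieBracket_add_right, mlieBracket_smul_right (f := (⁅W, f⁆ : SmoothFunction I M)),
      mlieBracket_smul_right f.mdifferentiableAt (hb W), hZx]
    · rfl
    · exact ContMDiffMap.mdifferentiableAt _
    · exact hZd.self_of_nhds
    · exact (ContMDiffMap.mdifferentiableAt _).smul_section hZd.self_of_nhds
    · exact f.mdifferentiableAt.smul_section (hb W)
  have hfZ : ContMDiffAt I I.tangent ∞
      (fun y => (⟨y, ((f : M → ℝ) • Z) y⟩ : TangentBundle I M)) x :=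
    f.contMDiff.contMDiffAt.smul_section hZ
  have j1 := leibniz_identity_mlieBracket_apply ((X.contMDiff x).of_le two_le_smooth)
      ((Y.contMDiff x).of_le two_le_smooth) (hfZ.of_le two_le_smooth)
  have j2 := leibniz_identity_mlieBracket_apply ((X.contMDiff x).of_le two_le_smooth)
      ((Y.contMDiff x).of_le two_le_smooth) (hZ.of_le two_le_smooth)
  have k := (key ⁅X, Y⁆).self_of_nhds
  simp only [Pi.add_apply, Pi.smul_apply', hZx] at k
  have k' : mlieBracket I (mlieBracket I X Y) ((f : M → ℝ) • Z) x =
    ⁅⁅X, Y⁆, f⁆ x • v + f x • mlieBracket I (mlieBracket I X Y) Z x := k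
  rw [key2, key2, k', j2, smul_add] at j1
  rw [sub_smul, eq_sub_iff_add_eq]
  have := sub_eq_zero.2 j1
  rw [← sub_eq_zero, ← neg_eq_zero, ← this]
  abel

instance : LieRingModule (SmoothVectorField I M) (SmoothFunction I M) where
  add_lie X Y f := by ext x; exact map_add (mvfderiv I f x) (X x) (Y x)
  lie_add X f g := by
    ext x
    exact congr($(mvfderiv_add (f.mdifferentiableAt (x := x)) g.mdifferentiableAt) (X x))
  leibniz_lie X Y f := by
    ext x
    change (⁅X, ⁅Y, f⁆⁆ : SmoothFunction I M) x =
      (⁅⁅X, Y⁆, f⁆ : SmoothFunction I M) x + (⁅Y, ⁅X, f⁆⁆ : SmoothFunction I M) x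
    rcases subsingleton_or_nontrivial E with hE | hE
    · have hz : ∀ (W : SmoothVectorField I M) (g : SmoothFunction I M),
          (⁅W, g⁆ : SmoothFunction I M) x = 0 := by
        intro W g
        have : W x = 0 := @Subsingleton.elim E hE _ _
        rw [lie_fun_apply, this, map_zero]
      rw [hz, hz, hz, add_zero]
    · obtain ⟨v, hv⟩ := exists_ne (0 : E)
      have h := lie_lie_fun_aux X Y f x v
      have h' := smul_left_injective ℝ (M := E) hv h
      rw [h']
      abel

instance : LieRinehartRing (SmoothFunction I M) (SmoothVectorField I M) where
  lie_smul_eq_mul' f g X := by ext x; exact map_smul (mvfderiv I g x) (f x) (X x)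
  leibniz_mul_right' X f g := by
    ext x
    have h := congr($(mvfderiv_mul (f.mdifferentiableAt (x := x)) g.mdifferentiableAt) (X x))
    refine h.trans ?_
    simp [mul_comm]
  leibniz_smul_right' X Y f := by
    have : CompleteSpace E := FiniteDimensional.complete ℝ E
    ext x
    refine (mlieBracket_smul_right f.mdifferentiableAt (Y.mdiffAt x)).trans ?_
    exact add_comm _ _

end SmoothVectorField
end Real

section Complex
variable {E : Type*} [NormedAddCommGroup E] [NormedSpace ℝ E]
  {H : Type*} [TopologicalSpace H] (I : ModelWithCorners ℝ E H)
  (M : Type*) [TopologicalSpace M] [ChartedSpace H M]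

/-- Multiplication of complex numbers is smooth over `ℝ`. -/
instance complexContMDiffRing : ContMDiffRing 𝓘(ℝ, ℂ) ∞ ℂ where
  toContMDiffAdd := inferInstance
  contMDiff_mul := by
    rw [← modelWithCornersSelf_prod, chartedSpaceSelf_prod]
    exact contDiff_mul.contMDiff

/-- Smooth complex-valued functions. -/
abbrev ComplexSmoothFunction := C^∞⟮I, M; 𝓘(ℝ, ℂ), ℂ⟯

variable {I M}
namespace ComplexSmoothFunction

/-- The real part of a complex-valued function. -/
def re (f : ComplexSmoothFunction I M) : SmoothFunction I M :=
  ⟨fun x => (f x).re, Complex.reCLM.contMDiff.comp f.contMDiff⟩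

/-- The imaginary part of a complex-valued function. -/
def im (f : ComplexSmoothFunction I M) : SmoothFunction I M :=
  ⟨fun x => (f x).im, Complex.imCLM.contMDiff.comp f.contMDiff⟩

/-- The complex-valued function `u + i v`. -/
def mk (u v : SmoothFunction I M) : ComplexSmoothFunction I M :=
  ⟨fun x => ⟨u x, v x⟩, by
    have h := (Complex.ofRealCLM.contMDiff.comp u.contMDiff).add
      ((contMDiff_const (c := Complex.I)).mul (Complex.ofRealCLM.contMDiff.comp v.contMDiff))
    convert! h using 1
    ext x
    simp [Complex.ext_iff]⟩

theorem ext_re_im {f g : ComplexSmoothFunction I M} (h : re f = re g) (h' : im f = im g) :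
    f = g := by
  ext x
  exact Complex.ext congr($h x) congr($h' x)

@[simp] theorem re_mk (u v : SmoothFunction I M) : re (mk u v) = u := rfl
@[simp] theorem im_mk (u v : SmoothFunction I M) : im (mk u v) = v := rfl
@[simp] theorem re_zero : re (0 : ComplexSmoothFunction I M) = 0 := rfl
@[simp] theorem im_zero : im (0 : ComplexSmoothFunction I M) = 0 := rfl
@[simp] theorem re_one : re (1 : ComplexSmoothFunction I M) = 1 := rfl
@[simp] theorem im_one : im (1 : ComplexSmoothFunction I M) = 0 := rfl
@[simp] theorem re_add (f g : ComplexSmoothFunction I M) : re (f + g) = re f + re g := rfl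
@[simp] theorem im_add (f g : ComplexSmoothFunction I M) : im (f + g) = im f + im g := rfl
@[simp] theorem re_mul (f g : ComplexSmoothFunction I M) :
    re (f * g) = re f * re g - im f * im g := rfl
@[simp] theorem im_mul (f g : ComplexSmoothFunction I M) :
    im (f * g) = re f * im g + im f * re g := rfl

end ComplexSmoothFunction

variable (I M) in
/-- Complex vector fields: smooth sections `X + i Y` of `TM ⊕ i TM`.  The Lie bracket and the
action on functions below are the complex-bilinear extensions of the real ones. -/
@[ext]
structure ComplexVectorField [IsManifold I ∞ M] where
  /-- The real part `X`. -/
  re : SmoothVectorField I M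
  /-- The imaginary part `Y`. -/
  im : SmoothVectorField I M

namespace ComplexVectorField
open ComplexSmoothFunction
variable [IsManifold I ∞ M]

instance : Zero (ComplexVectorField I M) := ⟨⟨0, 0⟩⟩
instance : Add (ComplexVectorField I M) := ⟨fun Z W => ⟨Z.re + W.re, Z.im + W.im⟩⟩
instance : Neg (ComplexVectorField I M) := ⟨fun Z => ⟨-Z.re, -Z.im⟩⟩
instance : Sub (ComplexVectorField I M) := ⟨fun Z W => ⟨Z.re - W.re, Z.im - W.im⟩⟩
instance : SMul ℕ (ComplexVectorField I M) := ⟨fun n Z => ⟨n • Z.re, n • Z.im⟩⟩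
instance : SMul ℤ (ComplexVectorField I M) := ⟨fun n Z => ⟨n • Z.re, n • Z.im⟩⟩

instance : AddCommGroup (ComplexVectorField I M) :=
  Function.Injective.addCommGroup (fun Z : ComplexVectorField I M => (Z.re, Z.im))
    (fun _ _ h => ComplexVectorField.ext congr($h.1) congr($h.2)) rfl (fun _ _ => rfl)
    (fun _ => rfl) (fun _ _ => rfl) (fun _ _ => rfl) (fun _ _ => rfl)

instance : SMul (ComplexSmoothFunction I M) (ComplexVectorField I M) :=
  ⟨fun f Z => ⟨ComplexSmoothFunction.re f • Z.re - ComplexSmoothFunction.im f • Z.im,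
    ComplexSmoothFunction.re f • Z.im + ComplexSmoothFunction.im f • Z.re⟩⟩

instance : Bracket (ComplexVectorField I M) (ComplexSmoothFunction I M) :=
  ⟨fun Z f => ComplexSmoothFunction.mk
    (⁅Z.re, ComplexSmoothFunction.re f⁆ - ⁅Z.im, ComplexSmoothFunction.im f⁆)
    (⁅Z.re, ComplexSmoothFunction.im f⁆ + ⁅Z.im, ComplexSmoothFunction.re f⁆)⟩

@[simp] theorem re_zero : (0 : ComplexVectorField I M).re = 0 := rfl
@[simp] theorem im_zero : (0 : ComplexVectorField I M).im = 0 := rfl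
@[simp] theorem re_add (Z W : ComplexVectorField I M) : (Z + W).re = Z.re + W.re := rfl
@[simp] theorem im_add (Z W : ComplexVectorField I M) : (Z + W).im = Z.im + W.im := rfl
@[simp] theorem re_smul (f : ComplexSmoothFunction I M) (Z : ComplexVectorField I M) :
    (f • Z).re = f.re • Z.re - f.im • Z.im := rfl
@[simp] theorem im_smul (f : ComplexSmoothFunction I M) (Z : ComplexVectorField I M) :
    (f • Z).im = f.re • Z.im + f.im • Z.re := rfl
@[simp] theorem re_lie_fun (Z : ComplexVectorField I M) (f : ComplexSmoothFunction I M) :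
    ComplexSmoothFunction.re ⁅Z, f⁆ =
      ⁅Z.re, ComplexSmoothFunction.re f⁆ - ⁅Z.im, ComplexSmoothFunction.im f⁆ := rfl
@[simp] theorem im_lie_fun (Z : ComplexVectorField I M) (f : ComplexSmoothFunction I M) :
    ComplexSmoothFunction.im ⁅Z, f⁆ =
      ⁅Z.re, ComplexSmoothFunction.im f⁆ + ⁅Z.im, ComplexSmoothFunction.re f⁆ := rfl

instance : Module (ComplexSmoothFunction I M) (ComplexVectorField I M) where
  one_smul Z := by ext1 <;> simp
  mul_smul f g Z := by
    ext1 <;> simp only [re_smul, im_smul, re_mul, im_mul] <;> module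
  smul_zero f := by ext1 <;> simp
  smul_add f Z W := by ext1 <;> simp only [re_smul, im_smul, re_add, im_add] <;> module
  add_smul f g Z := by
    ext1 <;> simp only [re_smul, im_smul, ComplexSmoothFunction.re_add,
      ComplexSmoothFunction.im_add, re_add, im_add] <;> module
  zero_smul Z := by ext1 <;> simp

variable [FiniteDimensional ℝ E]

instance : Bracket (ComplexVectorField I M) (ComplexVectorField I M) :=
  ⟨fun Z W => ⟨⁅Z.re, W.re⁆ - ⁅Z.im, W.im⁆, ⁅Z.re, W.im⁆ + ⁅Z.im, W.re⁆⟩⟩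

@[simp] theorem re_lie (Z W : ComplexVectorField I M) :
    ⁅Z, W⁆.re = ⁅Z.re, W.re⁆ - ⁅Z.im, W.im⁆ := rfl
@[simp] theorem im_lie (Z W : ComplexVectorField I M) :
    ⁅Z, W⁆.im = ⁅Z.re, W.im⁆ + ⁅Z.im, W.re⁆ := rfl

instance : LieRing (ComplexVectorField I M) where
  add_lie Z W U := by ext1 <;> simp <;> abel
  lie_add Z W U := by ext1 <;> simp <;> abel
  lie_self Z := by
    ext1
    · simp
    · rw [im_lie, ← lie_skew Z.re Z.im, neg_add_cancel, im_zero]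
  leibniz_lie Z W U := by
    ext1
    · simp only [re_lie, im_lie, re_add, lie_add, lie_sub, add_lie, sub_lie]
      rw [leibniz_lie Z.re W.re U.re, leibniz_lie Z.re W.im U.im, leibniz_lie Z.im W.re U.im,
        leibniz_lie Z.im W.im U.re]
      abel
    · simp only [re_lie, im_lie, im_add, lie_add, lie_sub, add_lie, sub_lie]
      rw [leibniz_lie Z.re W.re U.im, leibniz_lie Z.re W.im U.re, leibniz_lie Z.im W.re U.re,
        leibniz_lie Z.im W.im U.im]
      abel

instance : LieRingModule (ComplexVectorField I M) (ComplexSmoothFunction I M) where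
  add_lie Z W f := by
    apply ext_re_im <;> simp [add_lie] <;> abel
  lie_add Z f g := by
    apply ext_re_im <;> simp [lie_add] <;> abel
  leibniz_lie Z W f := by
    apply ext_re_im
    · change ⁅Z.re, ⁅W.re, f.re⁆ - ⁅W.im, f.im⁆⁆ - ⁅Z.im, ⁅W.re, f.im⁆ + ⁅W.im, f.re⁆⁆ =
        ⁅⁅Z.re, W.re⁆ - ⁅Z.im, W.im⁆, f.re⁆ - ⁅⁅Z.re, W.im⁆ + ⁅Z.im, W.re⁆, f.im⁆ +
        (⁅W.re, ⁅Z.re, f.re⁆ - ⁅Z.im, f.im⁆⁆ - ⁅W.im, ⁅Z.re, f.im⁆ + ⁅Z.im, f.re⁆⁆)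
      simp only [lie_add, lie_sub, add_lie, sub_lie]
      rw [leibniz_lie Z.re W.re f.re, leibniz_lie Z.re W.im f.im, leibniz_lie Z.im W.re f.im,
        leibniz_lie Z.im W.im f.re]
      abel
    · change ⁅Z.re, ⁅W.re, f.im⁆ + ⁅W.im, f.re⁆⁆ + ⁅Z.im, ⁅W.re, f.re⁆ - ⁅W.im, f.im⁆⁆ =
        ⁅⁅Z.re, W.re⁆ - ⁅Z.im, W.im⁆, f.im⁆ + ⁅⁅Z.re, W.im⁆ + ⁅Z.im, W.re⁆, f.re⁆ +
        (⁅W.re, ⁅Z.re, f.im⁆ + ⁅Z.im, f.re⁆⁆ + ⁅W.im, ⁅Z.re, f.re⁆ - ⁅Z.im, f.im⁆⁆)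
      simp only [lie_add, lie_sub, add_lie, sub_lie]
      rw [leibniz_lie Z.re W.re f.im, leibniz_lie Z.re W.im f.re, leibniz_lie Z.im W.re f.re,
        leibniz_lie Z.im W.im f.im]
      abel

instance : LieRinehartRing (ComplexSmoothFunction I M) (ComplexVectorField I M) where
  lie_smul_eq_mul' f g Z := by
    apply ext_re_im <;>
    simp only [re_lie_fun, im_lie_fun, re_smul, im_smul, re_mul, im_mul, add_lie, sub_lie,
      LieRinehartRing.lie_smul_eq_mul] <;> ring
  leibniz_mul_right' Z f g := by
    apply ext_re_im <;>
    simp only [re_lie_fun, im_lie_fun, re_mul, im_mul, lie_add, lie_sub, smul_eq_mul,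
      ComplexSmoothFunction.re_add, ComplexSmoothFunction.im_add,
      LieRinehartRing.leibniz_mul_right] <;> ring
  leibniz_smul_right' Z W f := by
    ext1 <;>
    simp only [re_lie_fun, im_lie_fun, re_smul, im_smul, re_add, im_add, re_lie, im_lie, lie_add,
      lie_sub, LieRinehartRing.leibniz_smul_right] <;> module

end ComplexVectorField
end Complex

end

end FrolicherNijenhuis

open FrolicherNijenhuis
open scoped Manifold ContDiff

/-!
An operator on `Ω` is determined by its values in degree `0` and its graded commutators with the
contractions `ι_X`, and these commutators are again simple operators: `[ι_X, i_K] = i_{K(X, …)}`,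
`[ι_X, d] = L_X`, `[ι_X, L_Y] = ι_[X, Y]`. By the graded Jacobi identity every identity between
operators built from `i_K` and `d` thus reduces to one between vector fields and endomorphisms.
In this way one finds `L_N² = L_T` for the torsion `T` of any endomorphism `N`. Hence
`[N, N] = 2T`, and `[N, T] = 0` because `L_N` commutes with its square. If `N` is a projection
with involutive image, `T` takes values in `Im N` and vanishes as soon as one argument lies in
`Im N`, so that `T(T(X, Y), Z) = 0`; this makes `i_T² = 0`, whence `[T, T] = 0` for the
Richardson-Nijenhuis bracket. Uniqueness of the brackets holds because `K` can be read off from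
`L_K f = Z ↦ K(Z)(f)` when vector fields are determined by their action on functions.
-/

namespace FrolicherNijenhuis

noncomputable section

open scoped Nat

section GradedCommutator
variable {A L : Type*} [CommRing A] [LieRing L] [Module A L]

theorem gradedCommutator_jacobi (k l m : ℤ) (P Q R : AddMonoid.End (Forms A L)) :
    gradedCommutator k (l + m) P (gradedCommutator l m Q R) =
      gradedCommutator (k + l) m (gradedCommutator k l P Q) R +
        (Int.negOnePow (k * l) : ℤ) • gradedCommutator l (k + m) Q (gradedCommutator k m P R) := by
  simp only [gradedCommutator, mul_add, add_mul, Int.negOnePow_add, mul_comm l k]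
  rcases Int.units_eq_one_or (k * l).negOnePow with h | h <;>
  rcases Int.units_eq_one_or (k * m).negOnePow with h' | h' <;>
  rcases Int.units_eq_one_or (l * m).negOnePow with h'' | h'' <;>
  · simp only [h, h', h'', mul_one, Units.val_one, one_smul, Units.val_neg, neg_smul, mul_neg,
      neg_neg]
    noncomm_ring

theorem gradedCommutator_jacobi_zero (k m : ℤ) (P Q R : AddMonoid.End (Forms A L)) :
    gradedCommutator k m P (gradedCommutator 0 m Q R) =
      gradedCommutator k m (gradedCommutator k 0 P Q) R +
        gradedCommutator 0 (k + m) Q (gradedCommutator k m P R) := by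
  simpa using gradedCommutator_jacobi k 0 m P Q R

theorem gradedCommutator_swap (k l : ℤ) (P Q : AddMonoid.End (Forms A L)) :
    gradedCommutator l k Q P = -(Int.negOnePow (k * l) : ℤ) • gradedCommutator k l P Q := by
  rcases Int.units_eq_one_or (k * l).negOnePow with h | h <;>
    simp [gradedCommutator, mul_comm l k, h, add_comm]

theorem gradedCommutator_apply (k l : ℤ) (P Q : AddMonoid.End (Forms A L)) (F : Forms A L)
    (Z : Fin p → L) :
    gradedCommutator k l P Q F p Z =
      P (Q F) p Z - (Int.negOnePow (k * l) : ℤ) • Q (P F) p Z :=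
  rfl

theorem gradedCommutator_sub_right (k l : ℤ) (P Q R : AddMonoid.End (Forms A L)) :
    gradedCommutator k l P (Q - R) = gradedCommutator k l P Q - gradedCommutator k l P R := by
  simp only [gradedCommutator, mul_sub, sub_mul, zsmul_sub]
  abel

theorem gradedCommutator_sub_left (k l : ℤ) (P Q R : AddMonoid.End (Forms A L)) :
    gradedCommutator k l (P - Q) R = gradedCommutator k l P R - gradedCommutator k l Q R := by
  simp only [gradedCommutator, mul_sub, sub_mul, zsmul_sub]
  abel

theorem gradedCommutator_mul_self (k : ℤ) {l : ℤ} (hl : Odd l)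
    (P Q : AddMonoid.End (Forms A L)) :
    gradedCommutator k (l + l) P (Q * Q) =
      gradedCommutator (k + l) l (gradedCommutator k l P Q) Q := by
  have sign_mul_self : Int.negOnePow (l * l) = -1 := Int.negOnePow_odd _ (hl.mul hl)
  rcases Int.units_eq_one_or (k * l).negOnePow with h | h <;>
  · simp only [gradedCommutator, mul_add, add_mul, Int.negOnePow_add, sign_mul_self, h, mul_neg,
      mul_one, neg_neg, Units.val_one, Units.val_neg, one_smul, neg_smul]
    noncomm_ring

theorem gradedCommutator_apply_zero (k l : ℤ) {P Q : AddMonoid.End (Forms A L)}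
    (hP : ∀ F, F 0 = 0 → P F 0 = 0) (hQ : ∀ F, Q F 0 = 0) (F : Forms A L) :
    gradedCommutator k l P Q F 0 = 0 := by
  ext Z
  rw [gradedCommutator_apply, hQ, hP _ (hQ F), AlternatingMap.zero_apply, smul_zero, sub_zero]

end GradedCommutator

section Ext
variable {A L : Type*} [CommRing A] [AddCommGroup L] [Module A L]

theorem end_ext {P Q : AddMonoid.End (Forms A L)}
    (h : ∀ (F : Forms A L) (p : ℕ) (Z : Fin p → L), P F p Z = Q F p Z) : P = Q :=
  AddMonoidHom.ext fun F => DFinsupp.ext fun p => AlternatingMap.ext fun Z => h F p Z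

end Ext

section Tuples
variable {α : Type*} {m n q : ℕ}

theorem insertNth_castAdd_append (i : Fin (m + 1)) (x : α) (u : Fin m → α) (v : Fin (q + 1) → α)
    (h : m + 1 + q = m + (q + 1)) :
    (Fin.castAdd (q + 1) i).insertNth (α := fun _ => α) x (Fin.append u v ∘ Fin.cast h) =
      Fin.append (i.insertNth (α := fun _ => α) x u) v := by
  refine Fin.insertNth_eq_iff.2 ⟨by simp, ((Equiv.comp_symm_eq (finCongr h) _ _).1 ?_).symm⟩
  ext k
  refine Fin.addCases (fun k => ?_) (fun k => ?_) k
  · have succAbove_castAdd :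
        (Fin.castAdd (q + 1) i).succAbove (Fin.cast h.symm (Fin.castAdd (q + 1) k)) =
          Fin.castAdd (q + 1) (i.succAbove k) := by
      simp [Fin.ext_iff, Fin.succAbove, Fin.lt_def, apply_ite Fin.val]
    simp [Fin.removeNth_apply, succAbove_castAdd]
  · have succAbove_natAdd :
        (Fin.castAdd (q + 1) i).succAbove (Fin.cast h.symm (Fin.natAdd m k)) =
          Fin.natAdd (m + 1) k := by
      rw [Fin.succAbove_of_le_castSucc _ _ (by simp [Fin.le_def]; omega)]
      simp [Fin.ext_iff, add_right_comm]
    simp [Fin.removeNth_apply, succAbove_natAdd]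

theorem insertNth_natAdd_append (j : Fin (q + 1)) (x : α) (u : Fin m → α) (v : Fin q → α) :
    (Fin.natAdd m j).insertNth (α := fun _ => α) x (Fin.append u v) =
      Fin.append u (j.insertNth (α := fun _ => α) x v) := by
  refine Fin.insertNth_eq_iff.2 ⟨by simp, ?_⟩
  ext k
  refine Fin.addCases (fun k => ?_) (fun k => ?_) k
  · have succAbove_castAdd :
        (Fin.natAdd m j).succAbove (Fin.castAdd q k) = Fin.castAdd (q + 1) k := by
      simp [Fin.ext_iff, Fin.succAbove, Fin.lt_def, apply_ite Fin.val]
      omega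
    simp [Fin.removeNth_apply, succAbove_castAdd]
  · have succAbove_natAdd :
        (Fin.natAdd m j).succAbove (Fin.natAdd m k) = Fin.natAdd m (j.succAbove k) := by
      simp [Fin.ext_iff, Fin.succAbove, Fin.lt_def, apply_ite Fin.val, apply_ite (m + ·), add_assoc]
    simp [Fin.removeNth_apply, succAbove_natAdd]

theorem vecCons_comp_cast (x : α) (Z : Fin n → α) (h : q = n) :
    Matrix.vecCons x Z ∘ Fin.cast (congrArg (· + 1) h) = Matrix.vecCons x (Z ∘ Fin.cast h) := by
  subst h
  rfl

end Tuples

section AlternatingMaps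
variable {R M N : Type*} [CommRing R] [AddCommGroup M] [Module R M] [AddCommGroup N] [Module R N]
  {n : ℕ}

theorem map_vecCons_vecCons_swap (f : M [⋀^Fin (n + 2)]→ₗ[R] N) (x y : M) (v : Fin n → M) :
    f (Matrix.vecCons x (Matrix.vecCons y v)) = -f (Matrix.vecCons y (Matrix.vecCons x v)) := by
  have insertNth_one : (1 : Fin (n + 2)).insertNth x (Matrix.vecCons y v) =
      Matrix.vecCons y (Matrix.vecCons x v) := by
    simpa [Matrix.vecCons] using Fin.insertNth_succ_cons 0 x y v
  rw [← insertNth_one, f.map_insertNth]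
  simp

theorem map_vecCons_removeNth (f : M [⋀^Fin (n + 1)]→ₗ[R] N) (j : Fin (n + 1)) (y : M)
    (v : Fin (n + 1) → M) :
    (-1 : ℤ) ^ (j : ℕ) • f (Matrix.vecCons y (j.removeNth v)) = f (Function.update v j y) := by
  rw [← f.map_insertNth, Fin.insertNth_removeNth]

end AlternatingMaps

section Permutations
variable {α G : Type*} [AddCommGroup G] {n : ℕ}

open Equiv.Perm in
theorem decomposeFin_symm_mul_cycleRange_bijective :
    Function.Bijective fun pe : Fin (n + 1) × Equiv.Perm (Fin n) =>
      decomposeFin.symm (0, pe.2) * pe.1.cycleRange := by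
  refine (Fintype.bijective_iff_injective_and_card _).2 ⟨?_, ?_⟩
  · rintro ⟨p, e⟩ ⟨p', e'⟩ (h : decomposeFin.symm (0, e) * p.cycleRange =
      decomposeFin.symm (0, e') * p'.cycleRange)
    have symm_zero (p : Fin (n + 1)) (e : Equiv.Perm (Fin n)) :
        (decomposeFin.symm (0, e) * p.cycleRange).symm 0 = p := by
      simp [Equiv.symm_apply_eq]
    obtain rfl : p = p' := by rw [← symm_zero p e, h, symm_zero]
    simpa using h
  · exact (Fintype.card_congr decomposeFin).symm

open Equiv.Perm in
theorem sum_sign_smul_vecCons (f : (Fin (n + 1) → α) → G) (x : α) (z : Fin n → α) :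
    ∑ σ : Equiv.Perm (Fin (n + 1)), sign σ • f (Matrix.vecCons x z ∘ σ) =
      ∑ p : Fin (n + 1), (-1 : ℤ) ^ (p : ℕ) •
        ∑ e : Equiv.Perm (Fin n), sign e • f (p.insertNth x (z ∘ e)) := by
  have vecCons_comp (p : Fin (n + 1)) (e : Equiv.Perm (Fin n)) :
      Matrix.vecCons x z ∘ (decomposeFin.symm (0, e) * p.cycleRange) =
        p.insertNth x (z ∘ e) := by
    rw [← Fin.cons_comp_cycleRange, coe_mul, ← Function.comp_assoc]
    congr 1
    ext i
    refine Fin.cases (by simp) (fun i => by simp) i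
  rw [← decomposeFin_symm_mul_cycleRange_bijective.sum_comp, Fintype.sum_prod_type]
  refine Finset.sum_congr rfl fun p _ => ?_
  rw [Finset.smul_sum]
  refine Finset.sum_congr rfl fun e _ => ?_
  dsimp only
  rw [vecCons_comp, Equiv.Perm.sign_mul, decomposeFin.symm_sign, Fin.sign_cycleRange, if_pos rfl,
    one_mul, mul_comm, mul_smul, Units.smul_def ((-1) ^ (p : ℕ))]
  push_cast
  rfl

end Permutations

section Insertion
variable {A L : Type*} [CommRing A] [AddCommGroup L] [Module A L] {m q : ℕ}

theorem insertionAux_append (K : VectorForm A L m) (θ : Form A L (q + 1)) (u : Fin m → L)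
    (v : Fin q → L) : insertionAux K θ (Fin.append u v) = θ (Matrix.vecCons (K u) v) := by
  simp [insertionAux, Matrix.vecCons]

theorem insertionAux_add (K K' : VectorForm A L m) (θ : Form A L (q + 1)) :
    insertionAux (K + K') θ = insertionAux K θ + insertionAux K' θ := by
  ext Z
  rw [← Fin.append_castAdd_natAdd (f := Z), add_apply, insertionAux_append,
    insertionAux_append, insertionAux_append, AlternatingMap.add_apply]
  exact congr($(map_add θ.curryLeft _ _) _)

theorem insertionAux_insertNth_castAdd (K : VectorForm A L (m + 1)) (θ : Form A L (q + 2))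
    (i : Fin (m + 1)) (x : L) (Z : Fin (m + 1 + q) → L) (h : m + (q + 1) = m + 1 + q) :
    insertionAux K θ ((Fin.castAdd (q + 1) i).insertNth x Z) =
      (-1 : ℤ) ^ (i : ℕ) • insertionAux (K.curryLeft x) θ (Z ∘ Fin.cast h) := by
  obtain ⟨u, v, rfl⟩ : ∃ (u : Fin m → L) (v : Fin (q + 1) → L),
      Z = Fin.append u v ∘ Fin.cast h.symm :=
    ⟨_, _, ((Equiv.eq_comp_symm (finCongr h) _ _).2 (Fin.append_castAdd_natAdd).symm)⟩
  have comp_cast_cancel : (Fin.append u v ∘ Fin.cast h.symm) ∘ Fin.cast h = Fin.append u v := rfl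
  rw [insertNth_castAdd_append, insertionAux_append, K.map_insertNth, comp_cast_cancel,
    insertionAux_append]
  exact congr($(map_zsmul θ.curryLeft _ (K (Matrix.vecCons x u))) v)

theorem insertionAux_insertNth_natAdd (K : VectorForm A L m) (θ : Form A L (q + 2))
    (j : Fin (q + 1)) (x : L) (Z : Fin (m + q) → L) :
    insertionAux K θ ((Fin.natAdd m j).insertNth x Z) =
      -(-1 : ℤ) ^ (j : ℕ) • insertionAux K (θ.curryLeft x) Z := by
  rw [← Fin.append_castAdd_natAdd (f := Z), insertNth_natAdd_append, insertionAux_append,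
    insertionAux_append]
  refine ((θ.curryLeft _).map_insertNth j x _).trans ?_
  rw [AlternatingMap.curryLeft_apply_apply, AlternatingMap.curryLeft_apply_apply,
    map_vecCons_vecCons_swap, smul_neg, neg_smul]

theorem sum_sign_smul_comp_cast {n p : ℕ} (h : p = n)
    (f : MultilinearMap A (fun _ : Fin p => L) A) (Z : Fin n → L) :
    ∑ e : Equiv.Perm (Fin n), Equiv.Perm.sign e • f ((Z ∘ e) ∘ Fin.cast h) =
      MultilinearMap.alternatization f (Z ∘ Fin.cast h) := by
  subst h
  rw [MultilinearMap.alternatization_apply]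
  rfl

theorem alternatization_insertionAux_vecCons (K : VectorForm A L (m + 1)) (θ : Form A L (q + 2))
    (x : L) (Z : Fin (m + 1 + q) → L) (h : m + (q + 1) = m + 1 + q) :
    MultilinearMap.alternatization (insertionAux K θ) (Matrix.vecCons x Z) =
      (m + 1) • MultilinearMap.alternatization (insertionAux (K.curryLeft x) θ) (Z ∘ Fin.cast h) +
        (q + 1) • (-1 : ℤ) ^ m •
          MultilinearMap.alternatization (insertionAux K (θ.curryLeft x)) Z := by
  have castAdd_summand (i : Fin (m + 1)) :
      (-1 : ℤ) ^ (i : ℕ) • ∑ e : Equiv.Perm (Fin (m + 1 + q)), Equiv.Perm.sign e •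
          insertionAux K θ ((Fin.castAdd (q + 1) i).insertNth x (Z ∘ e)) =
        MultilinearMap.alternatization (insertionAux (K.curryLeft x) θ) (Z ∘ Fin.cast h) := by
    simp only [insertionAux_insertNth_castAdd K θ i x _ h, smul_comm (Equiv.Perm.sign _),
      ← Finset.smul_sum, sum_sign_smul_comp_cast, smul_smul, ← mul_pow, one_pow, one_smul,
      neg_mul_neg, one_mul]
  have natAdd_summand (j : Fin (q + 1)) :
      (-1 : ℤ) ^ (m + 1 + j) • ∑ e : Equiv.Perm (Fin (m + 1 + q)), Equiv.Perm.sign e •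
          insertionAux K θ ((Fin.natAdd (m + 1) j).insertNth x (Z ∘ e)) =
        (-1 : ℤ) ^ m • MultilinearMap.alternatization (insertionAux K (θ.curryLeft x)) Z := by
    rw [MultilinearMap.alternatization_apply]
    simp only [insertionAux_insertNth_natAdd K θ j x, smul_comm (Equiv.Perm.sign _),
      ← Finset.smul_sum, smul_smul]
    congr 1
    rw [pow_add, pow_succ, mul_neg_one, neg_mul, neg_mul_neg, mul_assoc, ← mul_pow, neg_one_mul,
      neg_neg, one_pow, mul_one]
  rw [MultilinearMap.alternatization_apply]
  refine (sum_sign_smul_vecCons (n := m + 1 + q) (insertionAux K θ) x Z).trans ?_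
  refine (Fin.sum_univ_add (a := m + 1) (b := q + 1) _).trans ?_
  simp only [Fin.val_castAdd, Fin.val_natAdd, castAdd_summand, natAdd_summand, Finset.sum_const,
    Finset.card_univ, Fintype.card_fin]

variable [Algebra ℝ A]

theorem insertionSucc_vecCons (K : VectorForm A L (m + 1)) (θ : Form A L (q + 2)) (x : L)
    (Z : Fin (m + 1 + q) → L) (h : m + (q + 1) = m + 1 + q) :
    insertionSucc K θ (Matrix.vecCons x Z) =
      insertionSucc (K.curryLeft x) θ (Z ∘ Fin.cast h) +
        (-1 : ℤ) ^ m • insertionSucc K (θ.curryLeft x) Z := by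
  have cancel_left : (((m + 1) ! * (q + 1) ! : ℝ)⁻¹) * (m + 1 : ℕ) = (m ! * (q + 1) ! : ℝ)⁻¹ := by
    push_cast [Nat.factorial_succ]
    field_simp
  have cancel_right : (((m + 1) ! * (q + 1) ! : ℝ)⁻¹) * (q + 1 : ℕ) = ((m + 1) ! * q ! : ℝ)⁻¹ := by
    push_cast [Nat.factorial_succ]
    field_simp
  simp only [insertionSucc, AlternatingMap.smul_apply]
  rw [alternatization_insertionAux_vecCons K θ x Z h, smul_add, ← Nat.cast_smul_eq_nsmul ℝ,
    smul_smul, cancel_left, ← Nat.cast_smul_eq_nsmul ℝ (q + 1), smul_smul, cancel_right,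
    smul_comm ((-1 : ℤ) ^ m)]

end Insertion

section DirectSum
variable {β γ : ℕ → Type*} [∀ p, AddCommMonoid (β p)] [∀ p, AddCommMonoid (γ p)]
  (D : ∀ p, β p →+ DirectSum ℕ γ)

theorem toAddMonoid_apply_eq_zero {j : ℕ} (h : ∀ p x, D p x j = 0) (F : DirectSum ℕ β) :
    DirectSum.toAddMonoid D F j = 0 := by
  induction F using DirectSum.induction_on with
  | zero => rw [map_zero, DirectSum.zero_apply]
  | of p x => rw [DirectSum.toAddMonoid_of, h]
  | add F G hF hG => rw [map_add, DirectSum.add_apply, hF, hG, add_zero]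

theorem toAddMonoid_apply_eq {i j : ℕ} (h : ∀ p ≠ i, ∀ x, D p x j = 0) (F : DirectSum ℕ β) :
    DirectSum.toAddMonoid D F j = D i (F i) j := by
  induction F using DirectSum.induction_on with
  | zero => simp only [map_zero, DirectSum.zero_apply]
  | of p x =>
    rw [DirectSum.toAddMonoid_of]
    rcases eq_or_ne p i with rfl | hp
    · rw [DirectSum.of_eq_same]
    · rw [DirectSum.of_eq_of_ne _ _ _ hp.symm, h p hp, map_zero, DirectSum.zero_apply]
  | add F G hF hG => simp only [map_add, DirectSum.add_apply, hF, hG]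

end DirectSum

section Insertion
variable {A L : Type*} [CommRing A] [AddCommGroup L] [Module A L] [Algebra ℝ A] {m p q : ℕ}

theorem insertionSucc_add (K K' : VectorForm A L m) (θ : Form A L (q + 1)) :
    insertionSucc (K + K') θ = insertionSucc K θ + insertionSucc K' θ := by
  simp only [insertionSucc, insertionAux_add, map_add, smul_add]

theorem insertion_add (K K' : VectorForm A L m) :
    insertion (K + K') = insertion K + insertion K' := by
  refine DirectSum.addHom_ext fun p θ => ?_
  rw [AddMonoidHom.add_apply, insertion, insertion, insertion, DirectSum.toAddMonoid_of,
    DirectSum.toAddMonoid_of, DirectSum.toAddMonoid_of]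
  cases p with
  | zero => exact (add_zero 0).symm
  | succ q =>
    exact (congrArg (DirectSum.of (fun p => Form A L p) (m + q)) (insertionSucc_add K K' θ)).trans
      (map_add _ _ _)

/-- The insertion operator `i_K` as an additive function of `K`, with values in the ring of
operators on `Ω`. -/
def insertionEnd : VectorForm A L m →+ AddMonoid.End (Forms A L) :=
  AddMonoidHom.mk' insertion insertion_add

theorem insertionEnd_apply (K : VectorForm A L m) (F : Forms A L) (h : m + q = p) (Z : Fin p → L) :
    insertionEnd K F p Z = insertionSucc K (F (q + 1)) (Z ∘ Fin.cast h) := by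
  subst h
  have h : insertionEnd K F (m + q) = insertionSucc K (F (q + 1)) := by
    refine (toAddMonoid_apply_eq _ (i := q + 1) ?_ F).trans (DirectSum.of_eq_same _ _)
    rintro (_ | r) hr θ
    · rfl
    · exact DirectSum.of_eq_of_ne _ _ _ (by omega)
  exact congr($h Z)

theorem insertionEnd_apply_of_lt (K : VectorForm A L m) (F : Forms A L) (h : p < m) :
    insertionEnd K F p = 0 := by
  refine toAddMonoid_apply_eq_zero _ ?_ F
  rintro (_ | r) θ
  · rfl
  · exact DirectSum.of_eq_of_ne _ _ _ (by omega)

theorem insertionSucc_eq_smul_of_insertionAux_eq {K : VectorForm A L m} {θ : Form A L (q + 1)}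
    {η : Form A L (m + q)} (h : insertionAux K θ = η) :
    insertionSucc K θ = ((m ! * q ! : ℝ)⁻¹ * (m + q) !) • η := by
  rw [insertionSucc, h, AlternatingMap.coe_alternatization, Fintype.card_fin, mul_smul,
    Nat.cast_smul_eq_nsmul]

theorem insertionSucc_one_apply (K : VectorForm A L m) (θ : Form A L 1) (Z : Fin m → L) :
    insertionSucc K θ Z = θ ![K Z] := by
  have h : insertionAux K θ =
      (((AlternatingMap.ofSubsingleton A L A (0 : Fin 1)).symm θ).compAlternatingMap K :
        Form A L (m + 0)) := by
    ext W
    exact congrArg θ (funext fun i : Fin 1 => by rw [Subsingleton.elim i 0]; rfl)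
  have hm : (m ! : ℝ) ≠ 0 := by positivity
  have coeff : ((m ! * 0 ! : ℝ)⁻¹ * (m + 0) !) = 1 := by simp [hm]
  rw [insertionSucc_eq_smul_of_insertionAux_eq h, coeff, one_smul]
  exact congrArg θ (Matrix.vec_single_eq_const (K Z)).symm

variable (A) in
/-- A vector field as a vector-valued `0`-form. -/
def fieldForm : L →ₗ[A] VectorForm A L 0 :=
  (AlternatingMap.constLinearEquivOfIsEmpty (R' := A)).toLinearMap

variable (A) in
/-- The contraction `ι_X` of forms with a vector field `X`, as an additive function of `X`. -/
def contraction : L →+ AddMonoid.End (Forms A L) :=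
  insertionEnd.comp (fieldForm A).toAddMonoidHom

theorem contraction_eq_insertionEnd (X : L) : contraction A X = insertionEnd (fieldForm A X) :=
  rfl

theorem insertionSucc_fieldForm (X : L) (θ : Form A L (q + 1)) :
    insertionSucc (fieldForm A X) θ =
      (θ.curryLeft X).domDomCongr (finCongr (zero_add q).symm) := by
  have h : insertionAux (fieldForm A X) θ =
      (θ.curryLeft X).domDomCongr (finCongr (zero_add q).symm) := by
    ext Z
    exact congrArg (fun v => θ (Matrix.vecCons X v))
      (funext fun j => congrArg Z (Fin.ext (by simp)))
  have hq : ((0 ! * q ! : ℝ)⁻¹ * (0 + q) !) = 1 := by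
    rw [zero_add, Nat.factorial_zero, Nat.cast_one, one_mul, inv_mul_cancel₀ (by positivity)]
  rw [insertionSucc_eq_smul_of_insertionAux_eq h, hq, one_smul]

theorem contraction_apply (X : L) (F : Forms A L) (Z : Fin p → L) :
    contraction A X F p Z = F (p + 1) (Matrix.vecCons X Z) := by
  rw [contraction_eq_insertionEnd, insertionEnd_apply _ _ (zero_add p), insertionSucc_fieldForm]
  rfl

end Insertion

section Operators
variable {A L : Type*} [CommRing A] [AddCommGroup L] [Module A L] [Algebra ℝ A] {m p q : ℕ}

theorem insertionEnd_apply_zero (K : VectorForm A L (m + 1)) (F : Forms A L) :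
    insertionEnd K F 0 = 0 :=
  insertionEnd_apply_of_lt K F m.succ_pos

theorem contraction_apply_eq_curryLeft (X : L) (F : Forms A L) :
    contraction A X F p = (F (p + 1)).curryLeft X :=
  AlternatingMap.ext fun Z => contraction_apply X F Z

theorem insertionEnd_vecCons (X : L) (K : VectorForm A L (m + 1)) (F : Forms A L)
    (Z : Fin p → L) :
    insertionEnd K F (p + 1) (Matrix.vecCons X Z) =
      insertionEnd (K.curryLeft X) F p Z +
        (-1 : ℤ) ^ m • insertionEnd K (contraction A X F) p Z := by
  obtain hp | hp := lt_or_ge p m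
  · rw [insertionEnd_apply_of_lt _ _ hp, insertionEnd_apply_of_lt _ _ (by omega),
      insertionEnd_apply_of_lt _ _ (by omega)]
    simp
  obtain ⟨_ | q, hq⟩ := Nat.exists_eq_add_of_le hp
  · obtain rfl : m = p := hq.symm
    rw [insertionEnd_apply_of_lt _ _ m.lt_succ_self, insertionEnd_apply _ _ (add_zero _),
      insertionEnd_apply _ _ (add_zero _), insertionSucc_one_apply, insertionSucc_one_apply]
    simp
  · have hp : m + 1 + q = p := by omega
    rw [insertionEnd_apply K F (q := q + 1) (congrArg (· + 1) hp), insertionEnd_apply K _ hp,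
      insertionEnd_apply (K.curryLeft X) F hq.symm, contraction_apply_eq_curryLeft,
      vecCons_comp_cast X Z hp]
    exact insertionSucc_vecCons K (F (q + 2)) X _ (by omega)

end Operators

section Operators
variable {A L : Type*} [CommRing A] [LieRing L] [Module A L] [Algebra ℝ A] {m p : ℕ}

theorem gradedCommutator_contraction_apply (k : ℤ) (X : L) (P : AddMonoid.End (Forms A L))
    (F : Forms A L) (Z : Fin p → L) :
    gradedCommutator (-1) k (contraction A X) P F p Z =
      P F (p + 1) (Matrix.vecCons X Z) - (k.negOnePow : ℤ) • P (contraction A X F) p Z := by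
  rw [gradedCommutator_apply, contraction_apply, neg_one_mul, Int.negOnePow_neg]

theorem gradedCommutator_contraction_insertionEnd (X : L) (K : VectorForm A L (m + 1)) :
    gradedCommutator (-1) m (contraction A X) (insertionEnd K) = insertionEnd (K.curryLeft X) := by
  refine end_ext fun F p Z => ?_
  rw [gradedCommutator_contraction_apply, insertionEnd_vecCons, Int.coe_negOnePow_natCast,
    add_sub_cancel_right]

theorem operator_ext {P Q : AddMonoid.End (Forms A L)} (k : ℤ) (h0 : ∀ F, P F 0 = Q F 0)
    (h : ∀ X : L, gradedCommutator (-1) k (contraction A X) P =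
      gradedCommutator (-1) k (contraction A X) Q) : P = Q := by
  suffices h' : ∀ p F, P F p = Q F p from AddMonoidHom.ext fun F => DFinsupp.ext fun p => h' p F
  intro p F
  induction p generalizing F with
  | zero => exact h0 F
  | succ p ih =>
    ext Z
    have hX := congr($(h (Matrix.vecHead Z)) F p (Matrix.vecTail Z))
    rw [gradedCommutator_contraction_apply, gradedCommutator_contraction_apply, ih,
      Matrix.cons_head_tail] at hX
    exact sub_left_injective hX

end Operators

section ExtDeriv
variable {A L : Type*} [CommRing A] [LieRing L] [Module A L] [LieRingModule L A] [Algebra ℝ A]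
  [LieRinehartRing A L] {m n p : ℕ}

/-- The exterior derivative as an element of the ring of operators on `Ω`. -/
def extDerivEnd : AddMonoid.End (Forms A L) :=
  extDeriv

theorem extDerivEnd_apply_zero (F : Forms A L) : extDerivEnd F 0 = 0 := by
  refine toAddMonoid_apply_eq_zero _ ?_ F
  rintro (_ | p) θ <;> exact DirectSum.of_eq_of_ne _ _ _ (by simp)

theorem extDerivEnd_apply_one (F : Forms A L) : extDerivEnd F 1 = extDerivZero (F 0) := by
  refine (toAddMonoid_apply_eq _ (i := 0) ?_ F).trans (DirectSum.of_eq_same _ _)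
  rintro (_ | p) hp θ
  · exact absurd rfl hp
  · exact DirectSum.of_eq_of_ne _ _ _ (by simp)

theorem extDerivEnd_apply_add_two (F : Forms A L) :
    extDerivEnd F (n + 2) = extDerivSucc (F (n + 1)) := by
  refine (toAddMonoid_apply_eq _ (i := n + 1) ?_ F).trans (DirectSum.of_eq_same _ _)
  rintro (_ | p) hp θ <;> exact DirectSum.of_eq_of_ne _ _ _ (by grind)

theorem koszul_vecCons_add_koszul_curryLeft (θ : Form A L (n + 2)) (x : L) (Z : Fin (n + 2) → L) :
    koszul θ (Matrix.vecCons x Z) + koszul (θ.curryLeft x) Z =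
      ⁅x, θ Z⁆ - ∑ i, θ (Function.update Z i ⁅x, Z i⁆) := by
  have sum_pairs_eq_neg (i : Fin (n + 1)) : ∑ j ≥ i.succ, (-1 : ℤ) ^ (i + 1 + j : ℕ) •
          θ (Matrix.vecCons ⁅Z i.castSucc, Z j⁆
            (j.removeNth (Matrix.vecCons x (i.castSucc.removeNth Z)))) =
      -∑ j ≥ i, (-1 : ℤ) ^ (i + j : ℕ) • θ (Matrix.vecCons x
          (Matrix.vecCons ⁅Z i.castSucc, Z j.succ⁆ (j.removeNth (i.castSucc.removeNth Z)))) := by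
    have Ici_succ : Finset.Ici i.succ = (Finset.Ici i).map (Fin.succEmb (n + 1)) := by
      ext j
      refine Fin.cases ?_ (fun j => ?_) j <;> simp
    rw [Ici_succ, Finset.sum_map, ← Finset.sum_neg_distrib]
    refine Finset.sum_congr rfl fun j _ => ?_
    rw [Fin.coe_succEmb, removeNth_succ_vecCons, map_vecCons_vecCons_swap, smul_neg]
    congr 2
    rw [Fin.val_succ, show (i + 1 + (j + 1) : ℕ) = i + j + 2 by ring, pow_add]
    simp
  have lie_summand_eq_neg (k : Fin (n + 2)) : (-1 : ℤ) ^ ((k : ℕ) + 1) •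
      ⁅Z k, θ (Matrix.vecCons x (k.removeNth Z))⁆ =
      -((-1 : ℤ) ^ (k : ℕ) • ⁅Z k, θ (Matrix.vecCons x (k.removeNth Z))⁆) := by
    rw [pow_succ, mul_neg_one, neg_smul]
  rw [koszul_vecCons, koszul]
  simp only [sum_pairs_eq_neg, lie_summand_eq_neg, AlternatingMap.curryLeft_apply_apply,
    map_vecCons_removeNth, Finset.sum_neg_distrib]
  abel

theorem lieDerivative_eq {d : ℤ} (K : VectorForm A L m) (h : (m : ℤ) = d + 1) :
    lieDerivative K = gradedCommutator d 1 (insertionEnd K) extDerivEnd := by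
  rw [lieDerivative, h, add_sub_cancel_right]
  rfl

theorem gradedCommutator_contraction_extDerivEnd (X : L) :
    gradedCommutator (-1) 1 (contraction A X) extDerivEnd = lieDerivative (fieldForm A X) :=
  (lieDerivative_eq _ (by simp)).symm

theorem lieDerivative_fieldForm_apply (X : L) (F : Forms A L) (Z : Fin p → L) :
    lieDerivative (fieldForm A X) F p Z =
      ⁅X, F p Z⁆ - ∑ i, F p (Function.update Z i ⁅X, Z i⁆) := by
  rw [← gradedCommutator_contraction_extDerivEnd, gradedCommutator_contraction_apply]
  match p with
  | 0 =>
    rw [extDerivEnd_apply_one, extDerivEnd_apply_zero]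
    simp [extDerivZero, Subsingleton.elim Z ![]]
  | 1 =>
    rw [extDerivEnd_apply_add_two, extDerivEnd_apply_one, contraction_apply_eq_curryLeft]
    trans koszul (F 1) (Matrix.vecCons X Z) + ⁅Z 0, F 1 (Matrix.vecCons X ![])⁆
    · simp [extDerivSucc, extDerivZero]
    simp only [koszul_vecCons, map_vecCons_removeNth, Fin.sum_univ_succ, Finset.univ_eq_empty,
      Finset.sum_empty, add_zero, Fin.val_zero, zero_add, pow_one, neg_smul, one_smul,
      Subsingleton.elim ((0 : Fin 1).removeNth Z) ![]]
    abel
  | p + 2 =>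
    rw [extDerivEnd_apply_add_two, extDerivEnd_apply_add_two, contraction_apply_eq_curryLeft,
      ← koszul_vecCons_add_koszul_curryLeft]
    simp [extDerivSucc]

theorem gradedCommutator_contraction_lieDerivative_fieldForm (X Y : L) :
    gradedCommutator (-1) 0 (contraction A X) (lieDerivative (fieldForm A Y)) =
      contraction A ⁅X, Y⁆ := by
  refine end_ext fun F p Z => ?_
  have map_lie_swap : F (p + 1) (Fin.cons ⁅Y, X⁆ Z) = -F (p + 1) (Fin.cons ⁅X, Y⁆ Z) := by
    rw [← lie_skew]
    exact congr($(map_neg (F (p + 1)).curryLeft ⁅X, Y⁆) Z)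
  simp only [gradedCommutator_contraction_apply, lieDerivative_fieldForm_apply,
    contraction_apply, Fin.sum_univ_succ, Matrix.vecCons, Fin.update_cons_zero, ← Fin.cons_update,
    Fin.cons_zero, Fin.cons_succ, map_lie_swap, Int.negOnePow_zero, Units.val_one, one_smul]
  abel

end ExtDeriv

section Cartan
variable {A L : Type*} [CommRing A] [LieRing L] [Module A L] [LieRingModule L A] [Algebra ℝ A]
  [LieRinehartRing A L]

theorem lieDerivative_fieldForm_apply_zero (X : L) (F : Forms A L) (Z : Fin 0 → L) :
    lieDerivative (fieldForm A X) F 0 Z = ⁅X, F 0 Z⁆ := by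
  rw [lieDerivative_fieldForm_apply, Fin.sum_univ_zero, sub_zero]

theorem gradedCommutator_lieDerivative_fieldForm_contraction (X Y : L) :
    gradedCommutator 0 (-1) (lieDerivative (fieldForm A X)) (contraction A Y) =
      contraction A ⁅X, Y⁆ := by
  rw [gradedCommutator_swap (-1) 0, gradedCommutator_contraction_lieDerivative_fieldForm,
    ← lie_skew X Y, AddMonoidHom.map_neg, mul_zero, Int.negOnePow_zero, Units.val_one,
    neg_one_smul]

theorem gradedCommutator_lieDerivative_fieldForm (X Y : L) :
    gradedCommutator 0 0 (lieDerivative (fieldForm A X)) (lieDerivative (fieldForm A Y)) =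
      lieDerivative (fieldForm A ⁅X, Y⁆) := by
  refine operator_ext 0 (fun F => ?_) fun Z => ?_
  · ext W
    simp only [gradedCommutator_apply, lieDerivative_fieldForm_apply_zero, lie_lie, mul_zero,
      Int.negOnePow_zero, Units.val_one, one_smul]
  · rw [gradedCommutator_jacobi_zero, add_zero,
      gradedCommutator_contraction_lieDerivative_fieldForm,
      gradedCommutator_contraction_lieDerivative_fieldForm,
      gradedCommutator_contraction_lieDerivative_fieldForm,
      gradedCommutator_contraction_lieDerivative_fieldForm,
      gradedCommutator_lieDerivative_fieldForm_contraction, leibniz_lie Z, AddMonoidHom.map_add]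

theorem gradedCommutator_lieDerivative_fieldForm_extDerivEnd (X : L) :
    gradedCommutator 0 1 (lieDerivative (fieldForm A X)) extDerivEnd = 0 := by
  refine operator_ext 1 (fun F => ?_) fun Y => ?_
  · ext Z
    rw [gradedCommutator_apply, lieDerivative_fieldForm_apply_zero, extDerivEnd_apply_zero,
      extDerivEnd_apply_zero]
    simp
  · rw [gradedCommutator_jacobi_zero, neg_add_cancel,
      gradedCommutator_contraction_lieDerivative_fieldForm,
      gradedCommutator_contraction_extDerivEnd, gradedCommutator_contraction_extDerivEnd,
      gradedCommutator_lieDerivative_fieldForm, ← gradedCommutator_contraction_extDerivEnd,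
      ← gradedCommutator_contraction_extDerivEnd, ← lie_skew, AddMonoidHom.map_neg]
    simp [gradedCommutator]

end Cartan

section Endomorphisms
variable {A L : Type*} [CommRing A] [AddCommGroup L] [Module A L]

/-- The endomorphism `Y ↦ T(X, Y)`. -/
def evalFirst (T : VectorForm A L 2) (X : L) : L →ₗ[A] L :=
  (AlternatingMap.ofSubsingleton A L L (0 : Fin 1)).symm (T.curryLeft X)

theorem evalFirst_apply (T : VectorForm A L 2) (X Y : L) : evalFirst T X Y = T ![X, Y] := by
  rw [Matrix.vec_single_eq_const]
  rfl

end Endomorphisms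

section Endomorphisms
variable {A L : Type*} [CommRing A] [LieRing L] [Module A L]

theorem endForm_evalFirst (T : VectorForm A L 2) (X : L) :
    endForm (evalFirst T X) = T.curryLeft X :=
  Equiv.apply_symm_apply _ _

theorem endForm_add (B C : L →ₗ[A] L) : endForm (B + C) = endForm B + endForm C :=
  rfl

theorem endForm_zero : endForm (0 : L →ₗ[A] L) = 0 :=
  rfl

theorem endForm_sub (B C : L →ₗ[A] L) : endForm (B - C) = endForm B - endForm C :=
  rfl

end Endomorphisms

section Endomorphisms
variable {A L : Type*} [CommRing A] [LieRing L] [Module A L] [Algebra ℝ A]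

theorem gradedCommutator_contraction_endForm (X : L) (B : L →ₗ[A] L) :
    gradedCommutator (-1) 0 (contraction A X) (insertionEnd (endForm B)) = contraction A (B X) :=
  gradedCommutator_contraction_insertionEnd X (endForm B)

theorem gradedCommutator_contraction_insertionEnd_two (X : L) (T : VectorForm A L 2) :
    gradedCommutator (-1) 1 (contraction A X) (insertionEnd T) =
      insertionEnd (endForm (evalFirst T X)) := by
  rw [endForm_evalFirst]
  exact gradedCommutator_contraction_insertionEnd X T

theorem gradedCommutator_endForm_contraction (B : L →ₗ[A] L) (X : L) :
    gradedCommutator 0 (-1) (insertionEnd (endForm B)) (contraction A X) =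
      -contraction A (B X) := by
  rw [gradedCommutator_swap (-1) 0, gradedCommutator_contraction_endForm, mul_zero,
    Int.negOnePow_zero, Units.val_one, neg_one_smul]

theorem gradedCommutator_endForm_endForm (B C : L →ₗ[A] L) :
    gradedCommutator 0 0 (insertionEnd (endForm B)) (insertionEnd (endForm C)) =
      insertionEnd (endForm (C ∘ₗ B - B ∘ₗ C)) := by
  refine operator_ext 0 (fun F => ?_) fun X => ?_
  · rw [gradedCommutator_apply_zero 0 0 (fun F _ => insertionEnd_apply_zero _ F)
      (insertionEnd_apply_zero _), insertionEnd_apply_zero]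
  · rw [gradedCommutator_jacobi_zero, add_zero, gradedCommutator_contraction_endForm,
      gradedCommutator_contraction_endForm, gradedCommutator_contraction_endForm,
      gradedCommutator_contraction_endForm, gradedCommutator_endForm_contraction,
      ← sub_eq_add_neg, ← AddMonoidHom.map_sub]
    rfl

theorem insertionEnd_mul_self_eq_zero {T : VectorForm A L 2}
    (hT : ∀ X Y Z : L, T ![T ![X, Y], Z] = 0) : insertionEnd T * insertionEnd T = 0 := by
  have evalFirst_eq_zero (X Y : L) : evalFirst T (evalFirst T X Y) = 0 := by
    ext Z
    rw [evalFirst_apply, evalFirst_apply, hT, LinearMap.zero_apply]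
  have evalFirst_comp_eq_zero (X Y : L) : evalFirst T X ∘ₗ evalFirst T Y = 0 := by
    ext Z
    rw [LinearMap.comp_apply, evalFirst_apply, evalFirst_apply, map_vecCons_vecCons_swap, hT,
      neg_zero, LinearMap.zero_apply]
  have comm_evalFirst (X : L) :
      gradedCommutator 0 1 (insertionEnd (endForm (evalFirst T X))) (insertionEnd T) = 0 := by
    refine operator_ext 1 (fun F => ?_) fun Y => ?_
    · rw [gradedCommutator_apply_zero 0 1 (fun F _ => insertionEnd_apply_zero _ F)
        (insertionEnd_apply_zero _)]
      rfl
    · rw [gradedCommutator_jacobi_zero, neg_add_cancel, gradedCommutator_contraction_endForm,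
        gradedCommutator_contraction_insertionEnd_two,
        gradedCommutator_contraction_insertionEnd_two, gradedCommutator_endForm_endForm,
        evalFirst_eq_zero, evalFirst_comp_eq_zero, evalFirst_comp_eq_zero, sub_zero, endForm_zero,
        map_zero]
      simp [gradedCommutator]
  refine operator_ext 2 (fun F => insertionEnd_apply_zero _ _) fun X => ?_
  refine (gradedCommutator_mul_self (-1) odd_one _ _).trans ?_
  rw [gradedCommutator_contraction_insertionEnd_two, neg_add_cancel, comm_evalFirst]
  simp [gradedCommutator]

end Endomorphisms

section LieEnd
variable {A L : Type*} [CommRing A] [LieRing L] [Module A L] [LieRingModule L A]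
  [LieRinehartRing A L]

/-- The Lie derivative of an endomorphism along a vector field: `Y ↦ [X, BY] - B[X, Y]`. -/
def lieEnd (X : L) (B : L →ₗ[A] L) : L →ₗ[A] L where
  toFun Y := ⁅X, B Y⁆ - B ⁅X, Y⁆
  map_add' Y Z := by simp only [map_add, lie_add]; abel
  map_smul' a Y := by
    simp only [map_smul, map_add, LieRinehartRing.leibniz_smul_right, RingHom.id_apply]
    module

theorem lieEnd_apply (X Y : L) (B : L →ₗ[A] L) : lieEnd X B Y = ⁅X, B Y⁆ - B ⁅X, Y⁆ :=
  rfl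

theorem torsion_apply (N : L →ₗ[A] L) (Z : Fin 2 → L) : torsion N Z =
    ⁅N (Z 0), N (Z 1)⁆ - N ⁅N (Z 0), Z 1⁆ - N ⁅Z 0, N (Z 1)⁆ + N (N ⁅Z 0, Z 1⁆) :=
  rfl

theorem evalFirst_torsion (N : L →ₗ[A] L) (X : L) :
    evalFirst (torsion N) X = lieEnd (N X) N - N ∘ₗ lieEnd X N := by
  ext Y
  simp only [evalFirst_apply, torsion_apply, LinearMap.sub_apply, LinearMap.comp_apply,
    lieEnd_apply, map_sub, Matrix.cons_val_zero, Matrix.cons_val_one]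
  abel

theorem lieEnd_add_lieEnd (N : L →ₗ[A] L) (X Y : L) :
    lieEnd (lieEnd X N Y) N + lieEnd (N Y) (lieEnd X N) +
        (lieEnd Y N ∘ₗ lieEnd X N - lieEnd X N ∘ₗ lieEnd Y N) =
      lieEnd Y (N ∘ₗ lieEnd X N) +
        (evalFirst (torsion N) ⁅Y, X⁆ + lieEnd X (evalFirst (torsion N) Y)) := by
  rw [evalFirst_torsion, evalFirst_torsion, ← lie_skew]
  ext Z
  simp only [LinearMap.add_apply, LinearMap.sub_apply, LinearMap.comp_apply, lieEnd_apply, map_sub,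
    map_neg, lie_sub, sub_lie, neg_lie, lie_lie]
  abel

end LieEnd

section Cartan
variable {A L : Type*} [CommRing A] [LieRing L] [Module A L] [LieRingModule L A] [Algebra ℝ A]
  [LieRinehartRing A L] {m : ℕ}

theorem lieDerivative_sub (K K' : VectorForm A L m) :
    lieDerivative (K - K') = lieDerivative K - lieDerivative K' := by
  rw [lieDerivative_eq (d := m - 1) _ (by ring), lieDerivative_eq (d := m - 1) _ (by ring),
    lieDerivative_eq (d := m - 1) _ (by ring), map_sub, gradedCommutator_sub_left]

/-- The Lie derivative as an additive function of the vector-valued form. -/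
def lieDerivativeHom : VectorForm A L m →+ AddMonoid.End (Forms A L) :=
  AddMonoidHom.ofMapSub lieDerivative lieDerivative_sub

theorem lieDerivative_apply_zero (K : VectorForm A L (m + 1)) (F : Forms A L) :
    lieDerivative K F 0 = 0 := by
  ext Z
  rw [lieDerivative_eq (d := m) _ (by simp), gradedCommutator_apply, insertionEnd_apply_zero,
    extDerivEnd_apply_zero]
  simp

theorem lieDerivative_endForm (B : L →ₗ[A] L) :
    lieDerivative (endForm B) = gradedCommutator 0 1 (insertionEnd (endForm B)) extDerivEnd :=
  lieDerivative_eq _ rfl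

theorem gradedCommutator_lieDerivative_fieldForm_insertionEnd_apply_zero (l : ℤ) (X : L)
    (K : VectorForm A L (m + 1)) (F : Forms A L) :
    gradedCommutator 0 l (lieDerivative (fieldForm A X)) (insertionEnd K) F 0 = 0 := by
  refine gradedCommutator_apply_zero 0 l (fun F hF => ?_) (insertionEnd_apply_zero K) F
  ext Z
  rw [lieDerivative_fieldForm_apply_zero, hF, AlternatingMap.zero_apply, lie_zero]

theorem gradedCommutator_lieDerivative_fieldForm_endForm (X : L) (B : L →ₗ[A] L) :
    gradedCommutator 0 0 (lieDerivative (fieldForm A X)) (insertionEnd (endForm B)) =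
      insertionEnd (endForm (lieEnd X B)) := by
  refine operator_ext 0 (fun F => ?_) fun Y => ?_
  · rw [gradedCommutator_lieDerivative_fieldForm_insertionEnd_apply_zero, insertionEnd_apply_zero]
  · rw [gradedCommutator_jacobi_zero, add_zero,
      gradedCommutator_contraction_lieDerivative_fieldForm, gradedCommutator_contraction_endForm,
      gradedCommutator_contraction_endForm, gradedCommutator_contraction_endForm,
      gradedCommutator_lieDerivative_fieldForm_contraction, ← AddMonoidHom.map_add, lieEnd_apply,
      ← lie_skew, map_neg, neg_add_eq_sub]

theorem gradedCommutator_endForm_lieDerivative_fieldForm (X : L) (B : L →ₗ[A] L) :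
    gradedCommutator 0 0 (insertionEnd (endForm B)) (lieDerivative (fieldForm A X)) =
      -insertionEnd (endForm (lieEnd X B)) := by
  rw [gradedCommutator_swap 0 0, gradedCommutator_lieDerivative_fieldForm_endForm, mul_zero,
    Int.negOnePow_zero, Units.val_one, neg_one_smul]

theorem gradedCommutator_contraction_lieDerivative_endForm (X : L) (B : L →ₗ[A] L) :
    gradedCommutator (-1) 1 (contraction A X) (lieDerivative (endForm B)) =
      lieDerivative (fieldForm A (B X)) - insertionEnd (endForm (lieEnd X B)) := by
  rw [lieDerivative_endForm, gradedCommutator_jacobi_zero, neg_add_cancel,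
    gradedCommutator_contraction_endForm, gradedCommutator_contraction_extDerivEnd,
    gradedCommutator_contraction_extDerivEnd, gradedCommutator_endForm_lieDerivative_fieldForm,
    sub_eq_add_neg]

theorem gradedCommutator_lieDerivative_fieldForm_lieDerivative_endForm (X : L) (B : L →ₗ[A] L) :
    gradedCommutator 0 1 (lieDerivative (fieldForm A X)) (lieDerivative (endForm B)) =
      lieDerivative (endForm (lieEnd X B)) := by
  rw [lieDerivative_endForm, lieDerivative_endForm, gradedCommutator_jacobi_zero,
    gradedCommutator_lieDerivative_fieldForm_endForm, zero_add,
    gradedCommutator_lieDerivative_fieldForm_extDerivEnd]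
  simp [gradedCommutator]

theorem gradedCommutator_contraction_lieDerivative_two (X : L) (T : VectorForm A L 2) :
    gradedCommutator (-1) 2 (contraction A X) (lieDerivative T) =
      lieDerivative (endForm (evalFirst T X)) +
        gradedCommutator 0 1 (lieDerivative (fieldForm A X)) (insertionEnd T) := by
  have jacobi := gradedCommutator_jacobi (-1) 1 1 (contraction A X) (insertionEnd T) extDerivEnd
  rw [gradedCommutator_contraction_extDerivEnd, gradedCommutator_contraction_insertionEnd_two,
    neg_add_cancel, gradedCommutator_swap 0 1] at jacobi
  rw [lieDerivative_eq T (d := 1) rfl, lieDerivative_endForm]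
  simpa using jacobi

theorem gradedCommutator_lieEnd_lieDerivative_endForm (N : L →ₗ[A] L) (X : L) :
    gradedCommutator 0 1 (insertionEnd (endForm (lieEnd X N))) (lieDerivative (endForm N)) =
      lieDerivative (endForm (N ∘ₗ lieEnd X N)) -
        gradedCommutator 0 1 (lieDerivative (fieldForm A X)) (insertionEnd (torsion N)) := by
  refine operator_ext 1 (fun F => ?_) fun Y => ?_
  · rw [gradedCommutator_apply_zero 0 1 (fun F _ => insertionEnd_apply_zero _ F)
      (lieDerivative_apply_zero _)]
    exact (sub_eq_zero.2 ((lieDerivative_apply_zero _ F).trans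
      (gradedCommutator_lieDerivative_fieldForm_insertionEnd_apply_zero 1 X _ F).symm)).symm
  · rw [gradedCommutator_jacobi_zero, neg_add_cancel, gradedCommutator_sub_right,
      gradedCommutator_jacobi_zero, neg_add_cancel, gradedCommutator_contraction_endForm,
      gradedCommutator_contraction_lieDerivative_endForm,
      gradedCommutator_contraction_lieDerivative_endForm,
      gradedCommutator_contraction_lieDerivative_endForm, gradedCommutator_sub_right,
      gradedCommutator_endForm_lieDerivative_fieldForm, gradedCommutator_endForm_endForm,
      gradedCommutator_contraction_lieDerivative_fieldForm,
      gradedCommutator_contraction_insertionEnd_two,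
      gradedCommutator_contraction_insertionEnd_two,
      gradedCommutator_lieDerivative_fieldForm_endForm]
    have lieEnd_identity := congr(insertionEnd (endForm $(lieEnd_add_lieEnd N X Y)))
    simp only [endForm_add, map_add] at lieEnd_identity
    rw [← neg_add', ← sub_eq_add_neg, sub_sub, ← add_assoc, lieEnd_identity, ← sub_sub,
      LinearMap.comp_apply]

theorem lieDerivative_endForm_mul_self (N : L →ₗ[A] L) :
    lieDerivative (endForm N) * lieDerivative (endForm N) = lieDerivative (torsion N) := by
  refine operator_ext 2 (fun F => ?_) fun X => ?_
  · rw [lieDerivative_apply_zero]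
    exact lieDerivative_apply_zero _ (lieDerivative (endForm N) F)
  · refine (gradedCommutator_mul_self (-1) odd_one _ _).trans ?_
    rw [gradedCommutator_contraction_lieDerivative_endForm, neg_add_cancel,
      gradedCommutator_sub_left, gradedCommutator_lieDerivative_fieldForm_lieDerivative_endForm,
      gradedCommutator_lieEnd_lieDerivative_endForm,
      gradedCommutator_contraction_lieDerivative_two, evalFirst_torsion, endForm_sub,
      lieDerivative_sub, sub_sub_eq_add_sub, add_sub_right_comm]

end Cartan

section Insertion
variable {A L : Type*} [CommRing A] [AddCommGroup L] [Module A L] [Algebra ℝ A] {m : ℕ}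

theorem insertionEnd_apply_self (K : VectorForm A L m) (F : Forms A L) (Z : Fin m → L) :
    insertionEnd K F m Z = F 1 ![K Z] := by
  rw [insertionEnd_apply K F (add_zero m), insertionSucc_one_apply]
  rfl

theorem insertionEnd_of_zero (K : VectorForm A L m) (f : Form A L 0) :
    insertionEnd K (DirectSum.of (Form A L) 0 f) = 0 :=
  DirectSum.toAddMonoid_of _ _ _

end Insertion

section Faithful
variable {A L : Type*} [CommRing A] [LieRing L] [Module A L] [LieRingModule L A] [Algebra ℝ A]
  [LieRinehartRing A L] {m : ℕ}

theorem insertionEnd_extDerivEnd_apply_self (K : VectorForm A L m) (F : Forms A L)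
    (Z : Fin m → L) : insertionEnd K (extDerivEnd F) m Z = ⁅K Z, F 0 ![]⁆ := by
  rw [insertionEnd_apply_self, extDerivEnd_apply_one]
  rfl

theorem lieDerivative_of_zero_apply (K : VectorForm A L m) (f : A) (Z : Fin m → L) :
    lieDerivative K (DirectSum.of (Form A L) 0 (AlternatingMap.constOfIsEmpty A L (Fin 0) f)) m Z =
      ⁅K Z, f⁆ := by
  rw [lieDerivative_eq (d := m - 1) K (by ring), gradedCommutator_apply,
    insertionEnd_extDerivEnd_apply_self, insertionEnd_of_zero, DirectSum.of_eq_same]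
  simp

variable [LieModule.IsFaithful ℤ L A]

theorem lieDerivative_injective :
    Function.Injective (lieDerivative : VectorForm A L m → AddMonoid.End (Forms A L)) := by
  intro K K' h
  ext Z
  refine LieModule.ext_of_isFaithful (R := ℤ) A fun f => ?_
  rw [← lieDerivative_of_zero_apply, h, lieDerivative_of_zero_apply]

theorem insertion_injective :
    Function.Injective (insertion : VectorForm A L m → Forms A L →+ Forms A L) := by
  intro K K' h
  exact lieDerivative_injective (by rw [lieDerivative, h, lieDerivative])

theorem isFNBracket_endForm_self (N : L →ₗ[A] L) :
    IsFNBracket (k := 1) (l := 1) (endForm N) (endForm N) (2 • torsion N) := by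
  have comm : gradedCommutator (1 : ℕ) (1 : ℕ) (lieDerivative (endForm N))
      (lieDerivative (endForm N)) = lieDerivative (2 • torsion N) := by
    rw [gradedCommutator, lieDerivative_endForm_mul_self]
    refine Eq.trans ?_ (map_nsmul lieDerivativeHom 2 (torsion N)).symm
    simp [lieDerivativeHom, two_mul]
  exact ⟨comm, fun S hS => lieDerivative_injective (hS.symm.trans comm)⟩

theorem isFNBracket_endForm_neg_torsion (N : L →ₗ[A] L) :
    IsFNBracket (k := 1) (l := 2) (endForm N) (-torsion N) 0 := by
  have comm : gradedCommutator (1 : ℕ) (2 : ℕ) (lieDerivative (endForm N))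
      (lieDerivative (-torsion N)) = lieDerivative (0 : VectorForm A L (1 + 2)) := by
    have neg_torsion : lieDerivative (-torsion N) = -lieDerivative (torsion N) :=
      map_neg lieDerivativeHom _
    have zero : lieDerivative (0 : VectorForm A L (1 + 2)) = 0 := map_zero lieDerivativeHom
    rw [neg_torsion, zero, ← lieDerivative_endForm_mul_self, gradedCommutator]
    simp [mul_assoc, Int.negOnePow_even 2 even_two]
  exact ⟨comm, fun S hS => lieDerivative_injective (hS.symm.trans comm)⟩

theorem isRNBracket_self_zero {T : VectorForm A L 2}
    (hT : ∀ X Y Z : L, T ![T ![X, Y], Z] = 0) : IsRNBracket (k := 1) (l := 1) T T 0 := by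
  have comm : gradedCommutator (1 : ℕ) (1 : ℕ) (insertionEnd T) (insertionEnd T) =
      insertionEnd (0 : VectorForm A L (1 + 1 + 1)) := by
    rw [gradedCommutator, insertionEnd_mul_self_eq_zero hT, map_zero]
    simp
  exact ⟨comm, fun S hS => insertion_injective (hS.symm.trans comm)⟩

end Faithful

section Projection
variable {A L : Type*} [CommRing A] [LieRing L] [Module A L] [LieRingModule L A]
  [LieRinehartRing A L]

theorem apply_torsion {N : L →ₗ[A] L} (hN : N ∘ₗ N = N) (hI : HasInvolutiveImage N)
    (Z : Fin 2 → L) : N (torsion N Z) = torsion N Z := by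
  have lie_mem : N ⁅N (Z 0), N (Z 1)⁆ = ⁅N (Z 0), N (Z 1)⁆ :=
    (LinearMap.IsIdempotentElem.mem_range_iff hN).1 (hI _ ⟨_, rfl⟩ _ ⟨_, rfl⟩)
  have apply_apply (X : L) : N (N X) = N X := DFunLike.congr_fun hN X
  simp only [torsion_apply, map_add, map_sub, lie_mem, apply_apply]

theorem torsion_apply_left {N : L →ₗ[A] L} (hN : N ∘ₗ N = N) (hI : HasInvolutiveImage N)
    {X : L} (hX : N X = X) (Y : L) : torsion N ![X, Y] = 0 := by
  have lie_mem : N ⁅X, N Y⁆ = ⁅X, N Y⁆ :=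
    (LinearMap.IsIdempotentElem.mem_range_iff hN).1 (hI _ ⟨X, hX⟩ _ ⟨_, rfl⟩)
  have apply_apply (X : L) : N (N X) = N X := DFunLike.congr_fun hN X
  simp [torsion_apply, hX, lie_mem, apply_apply]

theorem torsion_torsion {N : L →ₗ[A] L} (hN : N ∘ₗ N = N) (hI : HasInvolutiveImage N)
    (X Y Z : L) : torsion N ![torsion N ![X, Y], Z] = 0 :=
  torsion_apply_left hN hI (apply_torsion hN hI _) Z

end Projection

section Manifold
open scoped Manifold ContDiff Bundle
variable {E : Type*} [NormedAddCommGroup E] [NormedSpace ℝ E] [FiniteDimensional ℝ E]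
  {H : Type*} [TopologicalSpace H] {I : ModelWithCorners ℝ E H}
  {M : Type*} [TopologicalSpace M] [ChartedSpace H M] [IsManifold I ∞ M] [T2Space M]

theorem SmoothVectorField.eq_zero_of_lie_eq_zero {X : SmoothVectorField I M}
    (h : ∀ f : SmoothFunction I M, ⁅X, f⁆ = 0) : X = 0 := by
  ext x
  have hinv : (mfderiv I 𝓘(ℝ, E) (extChartAt I x) x).IsInvertible :=
    isInvertible_mfderiv_extChartAt (mem_extChartAt_source x)
  suffices hv : mfderiv I 𝓘(ℝ, E) (extChartAt I x) x (X x) = 0 from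
    hinv.injective (hv.trans (map_zero _).symm)
  refine SeparatingDual.eq_zero_of_forall_dual_eq_zero (R := ℝ) (V := E) fun l => ?_
  let b : SmoothBumpFunction I x := Classical.arbitrary _
  let g : M → ℝ := fun y => l (extChartAt I x y)
  have hg : ContMDiffOn I 𝓘(ℝ, ℝ) ∞ g (chartAt H x).source :=
    l.contMDiff.comp_contMDiffOn contMDiffOn_extChartAt
  let f : SmoothFunction I M := ⟨fun y => b y • g y, b.contMDiff_smul hg⟩
  have hfg : (f : M → ℝ) =ᶠ[nhds x] g := by
    filter_upwards [b.eventuallyEq_one] with y hy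
    change b y • g y = g y
    rw [hy, Pi.one_apply, one_smul]
  have hd : HasMFDerivAt I 𝓘(ℝ, ℝ) g x (l.comp (mfderiv I 𝓘(ℝ, E) (extChartAt I x) x)) :=
    l.hasMFDerivAt.comp x (mdifferentiableAt_extChartAt (mem_chart_source H x)).hasMFDerivAt
  have hx : mvfderiv I f x (X x) = 0 := congr($(h f) x)
  have hm : mfderiv I 𝓘(ℝ, ℝ) f x = l.comp (mfderiv I 𝓘(ℝ, E) (extChartAt I x) x) :=
    hfg.mfderiv_eq.trans hd.mfderiv
  exact congr($hm (X x)).symm.trans hx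

theorem ComplexVectorField.eq_zero_of_lie_eq_zero {X : ComplexVectorField I M}
    (h : ∀ f : ComplexSmoothFunction I M, ⁅X, f⁆ = 0) : X = 0 := by
  have lie_re (f : SmoothFunction I M) : ⁅X.re, f⁆ = 0 := by
    simpa using congrArg ComplexSmoothFunction.re (h (ComplexSmoothFunction.mk f 0))
  have lie_im (f : SmoothFunction I M) : ⁅X.im, f⁆ = 0 := by
    simpa using congrArg ComplexSmoothFunction.im (h (ComplexSmoothFunction.mk f 0))
  ext1
  exacts [SmoothVectorField.eq_zero_of_lie_eq_zero lie_re,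
    SmoothVectorField.eq_zero_of_lie_eq_zero lie_im]

instance : LieModule.IsFaithful ℤ (SmoothVectorField I M) (SmoothFunction I M) :=
  (LieModule.isFaithful_iff' ..).2 fun _ => SmoothVectorField.eq_zero_of_lie_eq_zero

instance : LieModule.IsFaithful ℤ (ComplexVectorField I M) (ComplexSmoothFunction I M) :=
  (LieModule.isFaithful_iff' ..).2 fun _ => ComplexVectorField.eq_zero_of_lie_eq_zero

end Manifold

end

end FrolicherNijenhuis

theorem mainTheorem9_general {A L : Type*} [CommRing A] [LieRing L] [Module A L]
    [LieRingModule L A] [Algebra ℝ A] [LieRinehartRing A L] [LieModule.IsFaithful ℤ L A]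
    {N : L →ₗ[A] L} (hN : N ∘ₗ N = N) (hI : HasInvolutiveImage N) :
    N.compAlternatingMap (-torsion N) = -torsion N ∧
      IsFNBracket (k := 1) (l := 2) (endForm N) (-torsion N) 0 ∧
      IsRNBracket (k := 1) (l := 1) (-torsion N) (-torsion N) 0 ∧
      (∀ X Y Z : L, torsion N ![torsion N ![X, Y], Z] = 0) ∧
      IsFNBracket (k := 1) (l := 1) (endForm N) (endForm N) (2 • torsion N) := by
  refine ⟨?_, isFNBracket_endForm_neg_torsion N, isRNBracket_self_zero fun X Y Z => ?_,
    torsion_torsion hN hI, isFNBracket_endForm_self N⟩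
  · ext Z
    simp [apply_torsion hN hI]
  · rw [AlternatingMap.neg_apply, AlternatingMap.neg_apply, neg_eq_zero]
    exact torsion_apply_left hN hI (by rw [map_neg, apply_torsion hN hI]) Z

/-- First the case of real, then the case of complex vector fields.  The last conjunct says that the
explicit `torsion N` is half the Frölicher-Nijenhuis bracket of `N` with itself. -/
theorem mainTheorem9 {E : Type*} [NormedAddCommGroup E] [NormedSpace ℝ E] [FiniteDimensional ℝ E]
    {H : Type*} [TopologicalSpace H] (I : ModelWithCorners ℝ E H)
    (M : Type*) [TopologicalSpace M] [ChartedSpace H M] [IsManifold I ∞ M]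
    [BoundarylessManifold I M] [T2Space M] :
    (∀ N : SmoothVectorField I M →ₗ[SmoothFunction I M] SmoothVectorField I M,
      N ∘ₗ N = N → HasInvolutiveImage N →
      ∀ L : VectorForm (SmoothFunction I M) (SmoothVectorField I M) 2, L = -torsion N →
        N.compAlternatingMap L = -torsion N ∧
        IsFNBracket (k := 1) (l := 2) (endForm N) L 0 ∧
        IsRNBracket (k := 1) (l := 1) L L 0 ∧
        (∀ X Y Z : SmoothVectorField I M, torsion N ![torsion N ![X, Y], Z] = 0) ∧
        IsFNBracket (k := 1) (l := 1) (endForm N) (endForm N) (2 • torsion N)) ∧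
    (∀ N : ComplexVectorField I M →ₗ[ComplexSmoothFunction I M] ComplexVectorField I M,
      N ∘ₗ N = N → HasInvolutiveImage N →
      ∀ L : VectorForm (ComplexSmoothFunction I M) (ComplexVectorField I M) 2, L = -torsion N →
        N.compAlternatingMap L = -torsion N ∧
        IsFNBracket (k := 1) (l := 2) (endForm N) L 0 ∧
        IsRNBracket (k := 1) (l := 1) L L 0 ∧
        (∀ X Y Z : ComplexVectorField I M, torsion N ![torsion N ![X, Y], Z] = 0) ∧
        IsFNBracket (k := 1) (l := 1) (endForm N) (endForm N) (2 • torsion N)) := by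
  refine ⟨?_, ?_⟩ <;>
  · rintro N hN hI _ rfl
    exact mainTheorem9_general hN hI
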